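/- Let $1\le d\le n$ and $1\le k\le n$ be integers, let $a_1,\dots,a_n\in\mathbb R^d$ and $\lambda>0$. Let $$z_k=\min_{S\subseteq[n],\,|S|=k}\operatorname{tr}\Big(\big(\textstyle\sum_{i\in S}a_ia_i^\top+\lambda I_d\big)^{-1}\Big).$$ Let $A\in\mathbb R^{d\times n}$ be the matrix with columns $a_1,\dots,a_n$, let $C=A^\top A+\lambda I_n=H^\top H$ be the Cholesky factorization ($H$ upper triangular with positive diagonal), and let $h_i\in\mathbb R^n$ be the $i$-th column of $H$. For a positive semidefinite $Y\in\mathbb R^{n\times n}$ with eigenvalues $\beta_1\ge\dots\ge\beta_n\ge0$ put $$\Phi(Y)=\sum_{i=1}^{\iota}\frac1{\beta_i}+\frac{(k-\iota)^2}{\sum_{i=\iota+1}^n\beta_i},$$ where $\iota$ is the unique integer with $0\le\iota\le k-1$ and $\beta_\iota>\frac1{k-\iota}\sum_{i=\iota+1}^n\beta_i\ge\beta_{\iota+1}$ (with $\beta_0=\infty$). The AMESP-R relaxation value is $$\nu^M_k=\min_{x\in[0,1]^n}\Big\{\Phi\Big(\sum_{i=1}^n x_ih_ih_i^\top\Big)+\frac{d-k}{\lambda}:\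 \sum_{i=1}^n x_i=k\Big\}.$$ Then both minima are attained, and: (i) If $k\le d$, then $$1\le\frac{z_k}{\nu^M_k}\le\begin{cases}\min\left\{\frac{d-1}{d-k},\,n-k+1\right\}&\text{if }k\le d-1,\\ \min\{d,\,n-d+1\}&\text{if }k=d.\end{cases}$$ (ii) For all integers $d\ge1$, $k\ge d+1$ and $n>k$ there are $a_1,\dots,a_n\in\mathbb R^d$ and $\lambda>0$ with $\nu^M_k<0$ (for instance such vectors exist for $d=1$, $k=2$, $n=3$). -/

import Mathlib

open Matrix

namespace RAOD

/-- The `d × n` matrix `A` whose `i`-th column is the vector `a i`. -/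
def designMatrix {d n : ℕ} (a : Fin n → Fin d → ℝ) : Matrix (Fin d) (Fin n) ℝ :=
  (Matrix.of a)ᵀ

/-- The matrix `C = Aᵀ A + lam I_n`. -/
def covMatrix {d n : ℕ} (a : Fin n → Fin d → ℝ) (lam : ℝ) : Matrix (Fin n) (Fin n) ℝ :=
  (designMatrix a)ᵀ * designMatrix a + lam • (1 : Matrix (Fin n) (Fin n) ℝ)

theorem covMatrix_posDef {d n : ℕ} (a : Fin n → Fin d → ℝ) {lam : ℝ} (hlam : 0 < lam) :
    (covMatrix a lam).PosDef := by
  unfold covMatrix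
  refine Matrix.PosDef.posSemidef_add ?_ (Matrix.PosDef.one.smul hlam)
  simpa using Matrix.posSemidef_conjTranspose_mul_self (designMatrix a)

/-- The Cholesky factor of a real positive definite matrix `C`: the upper triangular matrix `H`
with positive diagonal and `Hᵀ H = C`, obtained from the decomposition `C = L D Lᵀ` as
`H = √D Lᵀ`. The three characterizing properties are proved below. -/
noncomputable def cholesky {n : ℕ} {C : Matrix (Fin n) (Fin n) ℝ} (hC : C.PosDef) :
    Matrix (Fin n) (Fin n) ℝ :=
  Matrix.diagonal (fun i => √(LDL.diagEntries hC i)) * (LDL.lower hC)ᵀ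

theorem diagEntries_pos {n : ℕ} {C : Matrix (Fin n) (Fin n) ℝ} (hC : C.PosDef) (i : Fin n) :
    0 < LDL.diagEntries hC i := by
  have hU : IsUnit (LDL.lowerInv hC) := isUnit_of_invertible _
  have h : (LDL.diag hC).PosDef := by
    rw [LDL.diag_eq_lowerInv_conj]
    exact hC.mul_mul_conjTranspose_same (Matrix.vecMul_injective_of_isUnit hU)
  simpa [LDL.diag] using h.diag_pos (i := i)

theorem cholesky_transpose_mul_self {n : ℕ} {C : Matrix (Fin n) (Fin n) ℝ} (hC : C.PosDef) :
    (cholesky hC)ᵀ * cholesky hC = C := by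
  conv_rhs => rw [← LDL.lower_conj_diag hC]
  have h : Matrix.diagonal (fun i => √(LDL.diagEntries hC i)) *
      Matrix.diagonal (fun i => √(LDL.diagEntries hC i)) = LDL.diag hC := by
    rw [Matrix.diagonal_mul_diagonal, LDL.diag]
    congr 1
    funext i
    exact Real.mul_self_sqrt (diagEntries_pos hC i).le
  simp only [cholesky, Matrix.transpose_mul, Matrix.transpose_transpose,
    Matrix.diagonal_transpose, Matrix.conjTranspose_eq_transpose_of_trivial]
  rw [← h]
  simp only [Matrix.mul_assoc]

theorem lower_upperTriangular {n : ℕ} {C : Matrix (Fin n) (Fin n) ℝ} (hC : C.PosDef) :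
    (LDL.lower hC)ᵀ.BlockTriangular id := by
  have h : ((LDL.lowerInv hC)ᵀ).BlockTriangular id := by
    intro i j hij
    exact LDL.lowerInv_triangular hC hij
  have hU : Invertible (LDL.lowerInv hC)ᵀ := inferInstance
  rw [LDL.lower, Matrix.transpose_nonsing_inv]
  exact Matrix.blockTriangular_inv_of_blockTriangular h

theorem cholesky_upperTriangular {n : ℕ} {C : Matrix (Fin n) (Fin n) ℝ} (hC : C.PosDef)
    {i j : Fin n} (hij : j < i) : cholesky hC i j = 0 := by
  rw [cholesky, Matrix.diagonal_mul, lower_upperTriangular hC hij, mul_zero]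

theorem lowerInv_diag {n : ℕ} {C : Matrix (Fin n) (Fin n) ℝ} (hC : C.PosDef) (i : Fin n) :
    LDL.lowerInv hC i i = 1 := by
  let _ := Cᵀ.toNormedAddCommGroup hC.transpose
  let _ := Cᵀ.toInnerProductSpace hC.transpose.posSemidef
  have h1 := congrFun (@InnerProductSpace.gramSchmidt_def'' ℝ (Fin n → ℝ) _
    (Cᵀ.toNormedAddCommGroup hC.transpose)
    (Cᵀ.toInnerProductSpace hC.transpose.posSemidef) (Fin n) _ _ _ (Pi.basisFun ℝ (Fin n)) i) i
  rw [Pi.add_apply, Finset.sum_apply, Finset.sum_eq_zero, add_zero] at h1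
  · rw [Pi.basisFun_apply, Pi.single_eq_same] at h1
    exact h1.symm
  · intro j hj
    have h2 : LDL.lowerInv hC j i = 0 := LDL.lowerInv_triangular hC (Finset.mem_Iio.1 hj)
    rw [Pi.smul_apply]
    exact smul_eq_zero_of_right _ h2

theorem cholesky_diag_pos {n : ℕ} {C : Matrix (Fin n) (Fin n) ℝ} (hC : C.PosDef)
    (i : Fin n) : 0 < cholesky hC i i := by
  have h : (LDL.lower hC * LDL.lowerInv hC) i i = 1 := by
    rw [LDL.lower, Matrix.inv_mul_of_invertible, Matrix.one_apply_eq]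
  rw [Matrix.mul_apply, Finset.sum_eq_single i, lowerInv_diag, mul_one] at h
  · rw [cholesky, Matrix.diagonal_mul, Matrix.transpose_apply, h, mul_one]
    exact Real.sqrt_pos.2 (diagEntries_pos hC i)
  · intro j _ hj
    rcases lt_or_gt_of_ne hj with h1 | h1
    · rw [LDL.lowerInv_triangular hC h1, mul_zero]
    · have h2 : LDL.lower hC i j = 0 := lower_upperTriangular hC h1
      rw [h2, zero_mul]
  · simp

/-- For `β_1 ≥ ⋯ ≥ β_m` (stored as `β 0, …, β (m - 1)`) and `k`, the integer `ι` satisfies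
`0 ≤ ι ≤ k - 1` and `β_ι > (1 / (k - ι)) ∑_{i > ι} β_i ≥ β_{ι + 1}`, where `β_0 = ∞`. -/
def IsSplitIndex {m : ℕ} (k : ℕ) (β : Fin m → ℝ) (ι : ℕ) : Prop :=
  ι < k ∧
  (∀ i : Fin m, (i : ℕ) + 1 = ι → (∑ j ∈ Finset.univ.filter (fun j : Fin m => ι ≤ (j : ℕ)), β j) / ((k : ℝ) - ι) < β i) ∧
  (∀ i : Fin m, (i : ℕ) = ι → β i ≤ (∑ j ∈ Finset.univ.filter (fun j : Fin m => ι ≤ (j : ℕ)), β j) / ((k : ℝ) - ι))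

theorem sum_tail_succ {m : ℕ} (β : Fin m → ℝ) (i : Fin m) :
    ∑ j ∈ Finset.univ.filter (fun j : Fin m => (i : ℕ) ≤ (j : ℕ)), β j =
      β i + ∑ j ∈ Finset.univ.filter (fun j : Fin m => (i : ℕ) + 1 ≤ (j : ℕ)), β j := by
  have h : Finset.univ.filter (fun j : Fin m => (i : ℕ) ≤ (j : ℕ)) =
      insert i (Finset.univ.filter (fun j : Fin m => (i : ℕ) + 1 ≤ (j : ℕ))) := by
    ext j
    simp only [Finset.mem_filter, Finset.mem_univ, true_and, Finset.mem_insert, Fin.ext_iff]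
    omega
  rw [h, Finset.sum_insert (by simp)]

/-- The splitting index exists and is unique. -/
theorem existsUnique_isSplitIndex {m k : ℕ} (hk : 1 ≤ k) (hkm : k ≤ m) (β : Fin m → ℝ)
    (hβ : Antitone β) (hβ0 : ∀ i, 0 ≤ β i) : ∃! ι, IsSplitIndex k β ι := by
  classical
  let T : ℕ → ℝ := fun t => ∑ j ∈ Finset.univ.filter (fun j : Fin m => t ≤ (j : ℕ)), β j
  have hT : ∀ i : Fin m, T i = β i + T (i + 1) := sum_tail_succ β
  have hT0 : ∀ t, 0 ≤ T t := fun t => Finset.sum_nonneg fun j _ => hβ0 j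
  let Q : ℕ → Prop := fun t => t < k ∧ ∀ i : Fin m, (i : ℕ) = t → β i ≤ T t / ((k : ℝ) - t)
  have hQ : ∃ t, Q t := by
    refine ⟨k - 1, by omega, fun i hi => ?_⟩
    have h1 : (k : ℝ) - ((k - 1 : ℕ) : ℝ) = 1 := by
      rw [Nat.cast_sub hk]; simp
    rw [h1, div_one, ← hi, hT i]
    linarith [hT0 (i + 1)]
  have hstep : ∀ i : Fin m, (i : ℕ) + 1 < k →
      (β i ≤ T i / ((k : ℝ) - (i : ℕ)) ↔
        β i ≤ T ((i : ℕ) + 1) / ((k : ℝ) - ((i : ℕ) + 1 : ℕ))) := by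
    intro i hi
    have h1 : ((i : ℕ) : ℝ) + 1 < k := by exact_mod_cast hi
    push_cast
    rw [le_div_iff₀ (by linarith), le_div_iff₀ (by linarith), hT i]
    constructor <;> intro h <;> linarith
  have hup : ∀ t s, Q t → t ≤ s → s < k → Q s := by
    intro t s ht hts
    induction s, hts using Nat.le_induction with
    | base => exact fun _ => ht
    | succ s _ ih =>
      intro hs
      obtain ⟨_, h2⟩ := ih (by omega)
      refine ⟨hs, fun i hi => ?_⟩
      have h3 := (hstep ⟨s, by omega⟩ hs).1 (h2 ⟨s, by omega⟩ rfl)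
      exact (hβ (Fin.le_def.2 (by simp [hi]))).trans h3
  have hiff : ∀ ι, IsSplitIndex k β ι ↔ Q ι ∧ ∀ t < ι, ¬ Q t := by
    intro ι
    constructor
    · rintro ⟨h1, h2, h3⟩
      refine ⟨⟨h1, h3⟩, fun t ht hQt => ?_⟩
      obtain ⟨s, rfl⟩ : ∃ s, ι = s + 1 := ⟨ι - 1, by omega⟩
      obtain ⟨_, h5⟩ := hup t s hQt (by omega) (by omega)
      have h6 := (hstep ⟨s, by omega⟩ h1).1 (h5 ⟨s, by omega⟩ rfl)
      exact absurd h6 (not_le.2 (h2 ⟨s, by omega⟩ rfl))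
    · rintro ⟨⟨h1, h3⟩, h4⟩
      refine ⟨h1, fun i hi => ?_, h3⟩
      subst hi
      by_contra hcon
      refine h4 i (by omega) ⟨by omega, fun j hj => ?_⟩
      obtain rfl : j = i := Fin.ext hj
      exact (hstep j h1).2 (not_lt.1 hcon)
  refine ⟨Nat.find hQ, (hiff _).2 ⟨Nat.find_spec hQ, fun t ht => Nat.find_min hQ ht⟩, ?_⟩
  intro ι hι
  obtain ⟨h1, h2⟩ := (hiff ι).1 hι
  refine le_antisymm (not_lt.1 fun h => h2 _ h (Nat.find_spec hQ)) (Nat.find_min' hQ h1)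

/-- The splitting index `ι` (the unique one, by `existsUnique_isSplitIndex`). -/
noncomputable def splitIndex {m : ℕ} (k : ℕ) (β : Fin m → ℝ) : ℕ :=
  sInf {ι | IsSplitIndex k β ι}

/-- `φ(β) = ∑_{i ≤ ι} 1 / β_i + (k - ι)² / ∑_{i > ι} β_i`. -/
noncomputable def phi {m : ℕ} (k : ℕ) (β : Fin m → ℝ) : ℝ :=
  (∑ i ∈ Finset.univ.filter (fun i : Fin m => (i : ℕ) < splitIndex k β), 1 / β i) +
    ((k : ℝ) - splitIndex k β) ^ 2 / ∑ i ∈ Finset.univ.filter (fun i : Fin m => splitIndex k β ≤ (i : ℕ)), β i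

/-- The spectral function `Φ(Y) = φ(β)` of a positive semidefinite matrix `Y`, where
`β_1 ≥ ⋯ ≥ β_n ≥ 0` are the eigenvalues of `Y` in nonincreasing order. -/
noncomputable def Phi {n : ℕ} (k : ℕ) (Y : Matrix (Fin n) (Fin n) ℝ) (hY : Y.PosSemidef) : ℝ :=
  phi k hY.isHermitian.eigenvalues₀

/-- `∑ i, x_i h_i h_iᵀ`, where `h_i` is the `i`-th column of `H`. -/
def weightedSum {n : ℕ} (H : Matrix (Fin n) (Fin n) ℝ) (x : Fin n → ℝ) :
    Matrix (Fin n) (Fin n) ℝ :=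
  ∑ i, x i • Matrix.vecMulVec (H.col i) (H.col i)

theorem weightedSum_posSemidef {n : ℕ} (H : Matrix (Fin n) (Fin n) ℝ) {x : Fin n → ℝ}
    (hx : ∀ i, x i ∈ Set.Icc (0 : ℝ) 1) : (weightedSum H x).PosSemidef := by
  unfold weightedSum
  refine Matrix.posSemidef_sum _ fun i _ => Matrix.PosSemidef.smul ?_ (hx i).1
  simpa using Matrix.posSemidef_vecMulVec_self_star (H.col i)

/-- The objective `f(S) = tr ((∑_{i ∈ S} a_i a_iᵀ + lam I_d)⁻¹)`. -/
noncomputable def objective {d n : ℕ} (a : Fin n → Fin d → ℝ) (lam : ℝ)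
    (S : Finset (Fin n)) : ℝ :=
  ((∑ i ∈ S, Matrix.vecMulVec (a i) (a i)) + lam • (1 : Matrix (Fin d) (Fin d) ℝ))⁻¹.trace

/-- The values of the regularized A-optimal design problem over all `S` with `|S| = k`. -/
def designValues {d n : ℕ} (a : Fin n → Fin d → ℝ) (lam : ℝ) (k : ℕ) : Set ℝ :=
  {v | ∃ S : Finset (Fin n), S.card = k ∧ v = objective a lam S}

/-- The optimal value `z_k` of the regularized A-optimal design problem. -/
noncomputable def z {d n : ℕ} (a : Fin n → Fin d → ℝ) (lam : ℝ) (k : ℕ) : ℝ :=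
  sInf (designValues a lam k)

/-- The values of the relaxation over all `x ∈ [0,1]^n` with `∑ x_i = k`. -/
def relaxationValues {d n : ℕ} (a : Fin n → Fin d → ℝ) {lam : ℝ} (hlam : 0 < lam) (k : ℕ) :
    Set ℝ :=
  {v | ∃ (x : Fin n → ℝ) (hx : ∀ i, x i ∈ Set.Icc (0 : ℝ) 1), ∑ i, x i = (k : ℝ) ∧
    v = Phi k (weightedSum (cholesky (covMatrix_posDef a hlam)) x)
      (weightedSum_posSemidef _ hx) + ((d : ℝ) - k) / lam}

/-- The optimal value `ν^M_k` of the relaxation. -/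
noncomputable def nuM {d n : ℕ} (a : Fin n → Fin d → ℝ) {lam : ℝ} (hlam : 0 < lam) (k : ℕ) :
    ℝ :=
  sInf (relaxationValues a hlam k)

end RAOD

/-!
Let `C = Hᵀ H` and let `β` be the spectrum of `∑ x_i h_i h_iᵀ`. Its elementary symmetric functions
are `e_j(β) = ∑_{|S| = j} x^S det C_S`, since `H D_x Hᵀ` and `D_x C` have the same characteristic
polynomial. For the indicator of a set `S` of size `k` this gives
`φ(β) ≤ ∑_{i ≤ k} 1 / β_i = e_{k-1}(β) / e_k(β) = tr (C_S⁻¹)`, and the Woodbury identity says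
`tr (C_S⁻¹) = f(S) - (d - k) / λ`, so the problem is a relaxation.

Conversely, draw `S` with `|S| = k` with probability proportional to `x^S det C_S`. Since
`det C_S · tr (C_S⁻¹) = ∑_{i ∈ S} det C_{S \ i}`, exchanging sums bounds the mean of `tr (C_S⁻¹)` by
`min {k, n - k + 1} · e_{k-1}(β) / e_k(β)`. Splitting off the `ι` largest eigenvalues one at a time
and using a Maclaurin-type inequality for the others gives `e_{k-1}(β) ≤ φ(β) e_k(β)`. Interpolating
between the resulting bound and the trivial `z_k ≤ d / λ` yields `z_k / ν_k ≤ d / (d - k + 1)`.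

The relaxed minimum exists because the feasible spectra form a compact set on which the first `k`
entries are positive, and there `φ` is continuous: it is glued from finitely many continuous
formulas on closed pieces, one for each value of the splitting index.
-/

namespace RAOD

section SymmetricFunctions

variable {σ : Type*}

theorem sum_powersetCard_sum_sdiff [DecidableEq σ] {M : Type*} [AddCommMonoid M]
    (s : Finset σ) (r : ℕ) (g : Finset σ → σ → M) :
    ∑ U ∈ s.powersetCard r, ∑ i ∈ s \ U, g U i =
      ∑ S ∈ s.powersetCard (r + 1), ∑ i ∈ S, g (S.erase i) i := by
  rw [Finset.sum_sigma', Finset.sum_sigma']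
  refine Finset.sum_bij' (fun p _ => ⟨insert p.2 p.1, p.2⟩) (fun p _ => ⟨p.1.erase p.2, p.2⟩)
    ?_ ?_ ?_ ?_ ?_
  · rintro ⟨U, i⟩ h
    simp only [Finset.mem_sigma, Finset.mem_powersetCard, Finset.mem_sdiff] at h ⊢
    obtain ⟨⟨hUs, hU⟩, hi, hiU⟩ := h
    exact ⟨⟨Finset.insert_subset hi hUs, by rw [Finset.card_insert_of_notMem hiU, hU]⟩,
      Finset.mem_insert_self _ _⟩
  · rintro ⟨S, i⟩ h
    simp only [Finset.mem_sigma, Finset.mem_powersetCard, Finset.mem_sdiff] at h ⊢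
    obtain ⟨⟨hSs, hS⟩, hi⟩ := h
    exact ⟨⟨(Finset.erase_subset _ _).trans hSs,
      by rw [Finset.card_erase_of_mem hi, hS, add_tsub_cancel_right]⟩,
      hSs hi, Finset.notMem_erase _ _⟩
  all_goals
    rintro ⟨U, i⟩ h
    simp only [Finset.mem_sigma, Finset.mem_sdiff] at h
    simp [h, Finset.insert_erase]

theorem sum_powersetCard_eq_sum_erase [DecidableEq σ] {M : Type*} [AddCommMonoid M]
    {S : Finset σ} {r : ℕ} (hS : S.card = r + 1) (g : Finset σ → M) :
    ∑ U ∈ S.powersetCard r, g U = ∑ i ∈ S, g (S.erase i) := by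
  have hself : S.powersetCard (r + 1) = {S} := hS ▸ Finset.powersetCard_self S
  have h := sum_powersetCard_sum_sdiff S r fun U _ => g U
  rw [hself, Finset.sum_singleton] at h
  rw [← h]
  refine Finset.sum_congr rfl fun U hU => ?_
  obtain ⟨hUS, hUr⟩ := Finset.mem_powersetCard.1 hU
  rw [Finset.sum_const, Finset.card_sdiff_of_subset hUS, hS, hUr, Nat.add_sub_cancel_left,
    one_smul]

theorem esymm_cons_succ {R : Type*} [CommSemiring R] (a : R) (s : Multiset R) (r : ℕ) :
    (a ::ₘ s).esymm (r + 1) = s.esymm (r + 1) + a * s.esymm r := by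
  simp only [Multiset.esymm, Multiset.powersetCard_cons, Multiset.map_add, Multiset.sum_add,
    Multiset.map_map, Function.comp_def, Multiset.prod_cons, Multiset.sum_map_mul_left]

theorem esymm_nonneg {R : Type*} [CommSemiring R] [PartialOrder R] [IsOrderedRing R]
    {s : Multiset R} (hs : ∀ a ∈ s, 0 ≤ a) (r : ℕ) : 0 ≤ s.esymm r := by
  refine Multiset.sum_nonneg fun b hb => ?_
  obtain ⟨t, ht, rfl⟩ := Multiset.mem_map.1 hb
  exact Multiset.prod_nonneg fun a ha =>
    hs a (Multiset.mem_of_le (Multiset.mem_powersetCard.1 ht).1 ha)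

variable {K : Type*} [Field K] [LinearOrder K] [IsStrictOrderedRing K]

theorem sum_mul_esymm_le {s : Finset σ} {f : σ → K} (hf : ∀ i ∈ s, 0 ≤ f i) (r : ℕ)
    (hle : ∀ i ∈ s, f i * (r + 1) ≤ ∑ j ∈ s, f j) :
    (∑ i ∈ s, f i) * (s.val.map f).esymm r ≤ (r + 1) ^ 2 * (s.val.map f).esymm (r + 1) := by
  classical
  rw [Finset.esymm_map_val, Finset.esymm_map_val]
  set T := ∑ i ∈ s, f i
  set E := ∑ U ∈ s.powersetCard r, ∏ i ∈ U, f i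
  have outside : ∑ U ∈ s.powersetCard r, (∑ i ∈ s \ U, f i) * ∏ j ∈ U, f j =
      (r + 1) * ∑ S ∈ s.powersetCard (r + 1), ∏ i ∈ S, f i := by
    simp only [Finset.sum_mul]
    rw [sum_powersetCard_sum_sdiff s r fun U i => f i * ∏ j ∈ U, f j, Finset.mul_sum]
    refine Finset.sum_congr rfl fun S hS => ?_
    rw [Finset.sum_congr rfl fun i hi => Finset.mul_prod_erase S f hi, Finset.sum_const,
      (Finset.mem_powersetCard.1 hS).2, nsmul_eq_mul, Nat.cast_add_one]
  have split : T * E = ∑ U ∈ s.powersetCard r, (∑ i ∈ s \ U, f i) * ∏ j ∈ U, f j +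
      ∑ U ∈ s.powersetCard r, (∑ i ∈ U, f i) * ∏ j ∈ U, f j := by
    rw [Finset.mul_sum, ← Finset.sum_add_distrib]
    refine Finset.sum_congr rfl fun U hU => ?_
    rw [← add_mul, Finset.sum_sdiff (Finset.mem_powersetCard.1 hU).1]
  have inside : (r + 1) * ∑ U ∈ s.powersetCard r, (∑ i ∈ U, f i) * ∏ j ∈ U, f j ≤ r * (T * E) := by
    rw [Finset.mul_sum, Finset.mul_sum, Finset.mul_sum]
    refine Finset.sum_le_sum fun U hU => ?_
    obtain ⟨hUs, hUr⟩ := Finset.mem_powersetCard.1 hU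
    rw [← mul_assoc, ← mul_assoc]
    refine mul_le_mul_of_nonneg_right ?_ (Finset.prod_nonneg fun i hi => hf i (hUs hi))
    calc ((r : K) + 1) * ∑ i ∈ U, f i = ∑ i ∈ U, f i * (r + 1) := by
          rw [mul_comm, Finset.sum_mul]
      _ ≤ ∑ _i ∈ U, T := Finset.sum_le_sum fun i hi => hle i (hUs hi)
      _ = r * T := by rw [Finset.sum_const, hUr, nsmul_eq_mul]
  rw [outside] at split
  linear_combination (r + 1) * split + inside

theorem esymm_add_le_mul_esymm_add {s t : Multiset K} (hs : ∀ a ∈ s, 0 < a) (ht : ∀ a ∈ t, 0 ≤ a)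
    {r : ℕ} {c : K} (hc : 0 ≤ c) (h : t.esymm r ≤ c * t.esymm (r + 1)) :
    (s + t).esymm (r + s.card) ≤ ((s.map (·⁻¹)).sum + c) * (s + t).esymm (r + s.card + 1) := by
  induction s using Multiset.induction_on with
  | empty => simpa using h
  | cons a s ih =>
    simp only [Multiset.mem_cons, forall_eq_or_imp] at hs
    obtain ⟨ha, hs⟩ := hs
    have hnn : ∀ j, 0 ≤ (s + t).esymm j := esymm_nonneg fun b hb =>
      (Multiset.mem_add.1 hb).elim (fun h => (hs b h).le) (ht b)
    have hsum : 0 ≤ (s.map (·⁻¹)).sum := Multiset.sum_nonneg <| by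
      simpa using fun b hb => (hs b hb).le
    rw [Multiset.cons_add, Multiset.card_cons, Multiset.map_cons, Multiset.sum_cons, ← add_assoc,
      esymm_cons_succ, esymm_cons_succ, add_assoc a⁻¹]
    specialize ih hs
    set R := (s.map (·⁻¹)).sum + c
    set e := (s + t).esymm
    set j := r + s.card
    calc e (j + 1) + a * e j ≤ e (j + 1) + a * (R * e (j + 1)) := by gcongr
      _ = (a⁻¹ + R) * (a * e (j + 1)) := by field_simp
      _ ≤ (a⁻¹ + R) * (e (j + 1 + 1) + a * e (j + 1)) := by
        gcongr
        linarith [hnn (j + 1 + 1)]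

end SymmetricFunctions

section SplitIndex

variable {m k ι : ℕ} {β : Fin m → ℝ}

/-- `∑_{i > ι} β_i` in the one-based numbering of the entries `β_1, …, β_m`. -/
def tailSum (ι : ℕ) (β : Fin m → ℝ) : ℝ :=
  ∑ j ∈ Finset.univ.filter (fun j : Fin m => ι ≤ (j : ℕ)), β j

/-- The formula defining `phi`, with an arbitrary index `ι` in place of the splitting index. -/
noncomputable def splitValue (k ι : ℕ) (β : Fin m → ℝ) : ℝ :=
  (∑ i ∈ Finset.univ.filter (fun i : Fin m => (i : ℕ) < ι), 1 / β i) +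
    ((k : ℝ) - ι) ^ 2 / tailSum ι β

/-- `IsSplitIndex` with both inequalities weak, so that the vectors `β` with a given weak
splitting index form a closed set. The price is that `ι` is no longer unique. -/
def IsWeakSplitIndex (k : ℕ) (β : Fin m → ℝ) (ι : ℕ) : Prop :=
  ι < k ∧ (∀ i : Fin m, (i : ℕ) + 1 = ι → tailSum ι β / ((k : ℝ) - ι) ≤ β i) ∧
    ∀ i : Fin m, (i : ℕ) = ι → β i ≤ tailSum ι β / ((k : ℝ) - ι)

/-- The nonincreasing nonnegative vectors whose first `k` entries are positive. This is the natural
domain of `phi k`: elsewhere `splitIndex` or a division may take a junk value. -/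
def phiDomain (m k : ℕ) : Set (Fin m → ℝ) :=
  {β | Antitone β ∧ (∀ i, 0 ≤ β i) ∧ ∀ i : Fin m, (i : ℕ) < k → 0 < β i}

theorem IsSplitIndex.isWeakSplitIndex (h : IsSplitIndex k β ι) : IsWeakSplitIndex k β ι :=
  ⟨h.1, fun i hi => (h.2.1 i hi).le, h.2.2⟩

theorem phi_eq_splitValue_splitIndex (k : ℕ) (β : Fin m → ℝ) :
    phi k β = splitValue k (splitIndex k β) β := rfl

theorem tailSum_eq_add_tailSum (β : Fin m → ℝ) (i : Fin m) :
    tailSum i β = β i + tailSum (i + 1) β :=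
  sum_tail_succ β i

theorem tailSum_pos (hβ : β ∈ phiDomain m k) (hι : ι < k) (hkm : k ≤ m) : 0 < tailSum ι β :=
  Finset.sum_pos' (fun j _ => hβ.2.1 j) ⟨⟨ι, by omega⟩, by simp, hβ.2.2 _ hι⟩

theorem isSplitIndex_splitIndex (hk : 1 ≤ k) (hkm : k ≤ m) (hβ : Antitone β)
    (hβ0 : ∀ i, 0 ≤ β i) : IsSplitIndex k β (splitIndex k β) :=
  Nat.sInf_mem (existsUnique_isSplitIndex hk hkm β hβ hβ0).exists

theorem splitIndex_eq (hkm : k ≤ m) (hβ : Antitone β) (hβ0 : ∀ i, 0 ≤ β i)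
    (h : IsSplitIndex k β ι) : splitIndex k β = ι :=
  have hk : 1 ≤ k := Nat.one_le_iff_ne_zero.2 (Nat.ne_zero_of_lt h.1)
  (existsUnique_isSplitIndex hk hkm β hβ hβ0).unique (isSplitIndex_splitIndex hk hkm hβ hβ0) h

theorem splitValue_succ_eq (i : Fin m) (hi : 0 < β i) (hik : (i : ℕ) + 1 < k)
    (h : tailSum (i + 1) β / ((k : ℝ) - (i + 1 : ℕ)) = β i) :
    splitValue k (i + 1) β = splitValue k i β := by
  have hc : (0 : ℝ) < k - (i + 1) := by
    rw [sub_pos]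
    exact_mod_cast hik
  have hfilter : Finset.univ.filter (fun j : Fin m => (j : ℕ) < i + 1) =
      insert i (Finset.univ.filter (fun j : Fin m => (j : ℕ) < i)) := by
    ext j
    simp only [Finset.mem_filter, Finset.mem_univ, true_and, Finset.mem_insert, Fin.ext_iff]
    omega
  push_cast at h
  rw [div_eq_iff hc.ne'] at h
  have hi' : tailSum i β = β i * (k - i) := by
    rw [tailSum_eq_add_tailSum, h]
    ring
  rw [splitValue, splitValue, hfilter, Finset.sum_insert (by simp), h, hi']
  have hki : (0 : ℝ) < k - i := by linarith
  push_cast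
  field_simp [hki.ne']
  ring

theorem IsWeakSplitIndex.of_succ (hβ : Antitone β) (i : Fin m)
    (hi : IsWeakSplitIndex k β (i + 1))
    (h : tailSum (i + 1) β / ((k : ℝ) - (i + 1 : ℕ)) = β i) : IsWeakSplitIndex k β i := by
  have hik : (0 : ℝ) < k - (i + 1 : ℕ) := by
    rw [sub_pos]
    exact_mod_cast hi.1
  have hmean : tailSum i β / ((k : ℝ) - i) = β i := by
    rw [div_eq_iff hik.ne'] at h
    push_cast at h hik
    rw [tailSum_eq_add_tailSum, h, div_eq_iff (by linarith)]
    ring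
  refine ⟨(Nat.lt_succ_self _).trans hi.1, fun j hj => ?_, fun j hj => ?_⟩ <;> rw [hmean]
  · exact hβ (Fin.le_def.2 (by omega))
  · exact hβ (Fin.le_def.2 hj.ge)

/-- Consecutive weak splitting indices give equal values, so one can descend to the strict one. -/
theorem phi_eq_splitValue (hkm : k ≤ m) (hβ : β ∈ phiDomain m k)
    (h : IsWeakSplitIndex k β ι) : phi k β = splitValue k ι β := by
  induction ι with
  | zero =>
    rw [phi_eq_splitValue_splitIndex, splitIndex_eq hkm hβ.1 hβ.2.1
      ⟨h.1, fun i hi => absurd hi (Nat.succ_ne_zero _), h.2.2⟩]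
  | succ ι ih =>
    let i : Fin m := ⟨ι, by have := h.1; omega⟩
    rcases (h.2.1 i rfl).lt_or_eq with hlt | heq
    · rw [phi_eq_splitValue_splitIndex, splitIndex_eq hkm hβ.1 hβ.2.1 ⟨h.1, fun j hj => ?_, h.2.2⟩]
      obtain rfl : j = i := Fin.ext (Nat.succ_injective hj)
      exact hlt
    · rw [ih (.of_succ hβ.1 i h heq)]
      exact (splitValue_succ_eq i (hβ.2.2 i (Nat.lt_of_succ_lt h.1)) h.1 heq).symm

theorem phi_pos (hk : 1 ≤ k) (hkm : k ≤ m) (hβ : β ∈ phiDomain m k) : 0 < phi k β := by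
  have h := isSplitIndex_splitIndex hk hkm hβ.1 hβ.2.1
  have hc : (0 : ℝ) < k - splitIndex k β := by
    rw [sub_pos]
    exact_mod_cast h.1
  have hT := tailSum_pos hβ h.1 hkm
  rw [phi_eq_splitValue_splitIndex, splitValue]
  exact add_pos_of_nonneg_of_pos
    (Finset.sum_nonneg fun i _ => one_div_nonneg.2 (hβ.2.1 i)) (by positivity)

theorem splitValue_le_sum_inv (hkm : k ≤ m) (hβ : β ∈ phiDomain m k) (hι : ι < k) :
    splitValue k ι β ≤ ∑ i ∈ Finset.univ.filter (fun i : Fin m => (i : ℕ) < k), (β i)⁻¹ := by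
  set middle := Finset.univ.filter fun i : Fin m => ι ≤ (i : ℕ) ∧ (i : ℕ) < k
  have hsplit : Finset.univ.filter (fun i : Fin m => (i : ℕ) < k) =
      Finset.univ.filter (fun i : Fin m => (i : ℕ) < ι) ∪ middle := by
    ext i
    simp only [middle, Finset.mem_filter, Finset.mem_univ, true_and, Finset.mem_union]
    omega
  have hdisj : Disjoint (Finset.univ.filter fun i : Fin m => (i : ℕ) < ι) middle :=
    Finset.disjoint_filter.2 fun i _ h h' => by omega
  have hcard : (middle.card : ℝ) = k - ι := by
    have h := congrArg Finset.card hsplit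
    rw [Finset.card_union_of_disjoint hdisj, Fin.card_filter_val_lt, Fin.card_filter_val_lt,
      min_eq_right hkm, min_eq_right (hι.le.trans hkm)] at h
    rw [h]
    push_cast
    ring
  have hpos : ∀ i ∈ middle, 0 < β i := fun i hi => hβ.2.2 i (Finset.mem_filter.1 hi).2.2
  have hmiddle : 0 < ∑ i ∈ middle, β i :=
    Finset.sum_pos hpos ⟨⟨ι, by omega⟩, by simp [middle, hι]⟩
  rw [splitValue, hsplit, Finset.sum_union hdisj]
  simp only [one_div]
  gcongr
  calc ((k : ℝ) - ι) ^ 2 / tailSum ι β ≤ ((k : ℝ) - ι) ^ 2 / ∑ i ∈ middle, β i := by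
        have hsub : middle ⊆ Finset.univ.filter fun i : Fin m => ι ≤ (i : ℕ) :=
          Finset.monotone_filter_right _ fun i _ hi => hi.1
        gcongr
        exact Finset.sum_le_sum_of_subset_of_nonneg hsub fun i _ _ => hβ.2.1 i
    _ = (∑ _i ∈ middle, (1 : ℝ)) ^ 2 / ∑ i ∈ middle, β i := by simp [hcard]
    _ ≤ ∑ i ∈ middle, 1 ^ 2 / β i := Finset.sq_sum_div_le_sum_sq_div _ _ hpos
    _ = ∑ i ∈ middle, (β i)⁻¹ := by simp

theorem phi_le_sum_inv (hk : 1 ≤ k) (hkm : k ≤ m) (hβ : β ∈ phiDomain m k) :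
    phi k β ≤ ∑ i ∈ Finset.univ.filter (fun i : Fin m => (i : ℕ) < k), (β i)⁻¹ :=
  splitValue_le_sum_inv hkm hβ (isSplitIndex_splitIndex hk hkm hβ.1 hβ.2.1).1

theorem tailSum_mul_esymm_tail_le (hβ : Antitone β) (hβ0 : ∀ i, 0 ≤ β i) {r : ℕ}
    (h : ∀ i : Fin m, (i : ℕ) = ι → β i * (r + 1) ≤ tailSum ι β) :
    tailSum ι β * ((Finset.univ.filter fun i : Fin m => ι ≤ (i : ℕ)).val.map β).esymm r ≤
      (r + 1) ^ 2 *
        ((Finset.univ.filter fun i : Fin m => ι ≤ (i : ℕ)).val.map β).esymm (r + 1) := by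
  refine sum_mul_esymm_le (fun i _ => hβ0 i) r fun i hi => ?_
  have hιi : ι ≤ i := (Finset.mem_filter.1 hi).2
  exact (mul_le_mul_of_nonneg_right (hβ (Fin.mk_le_of_le_val hιi)) (by positivity)).trans
    (h ⟨ι, by omega⟩ rfl)

theorem esymm_le_phi_mul_esymm (hkm : k < m) (hβ : β ∈ phiDomain m (k + 1)) :
    (Finset.univ.val.map β).esymm k ≤ phi (k + 1) β * (Finset.univ.val.map β).esymm (k + 1) := by
  have hι := isSplitIndex_splitIndex (Nat.le_add_left 1 k) hkm hβ.1 hβ.2.1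
  rw [phi_eq_splitValue_splitIndex]
  generalize splitIndex (k + 1) β = ι at hι
  obtain ⟨r, rfl⟩ : ∃ r, k = r + ι := ⟨k - ι, by have := hι.1; omega⟩
  set head := Finset.univ.filter fun i : Fin m => (i : ℕ) < ι
  set tail := Finset.univ.filter fun i : Fin m => ι ≤ (i : ℕ)
  have hunion : Finset.univ.val.map β = head.val.map β + tail.val.map β := by
    rw [← Multiset.map_add]
    simp only [head, tail, Finset.filter_val, ← not_lt]
    rw [Multiset.filter_add_not]
  have hcard : (head.val.map β).card = ι := by
    rw [Multiset.card_map, Finset.card_val, Fin.card_filter_val_lt]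
    omega
  have hr : ((r + ι + 1 : ℕ) : ℝ) - ι = r + 1 := by
    push_cast
    ring
  have hT : 0 < tailSum ι β := tailSum_pos hβ hι.1 hkm
  have htail : (tail.val.map β).esymm r ≤
      (r + 1) ^ 2 / tailSum ι β * (tail.val.map β).esymm (r + 1) := by
    rw [div_mul_eq_mul_div, le_div_iff₀' hT]
    refine tailSum_mul_esymm_tail_le hβ.1 hβ.2.1 fun i hi => ?_
    have h : β i ≤ tailSum ι β / _ := hι.2.2 i hi
    rwa [hr, le_div_iff₀ (by positivity)] at h
  have key := esymm_add_le_mul_esymm_add (s := head.val.map β) (by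
      simpa [head] using fun i hi => hβ.2.2 i (by omega)) (by simpa using fun i _ => hβ.2.1 i)
    (by positivity) htail
  rw [← hunion, hcard, Multiset.map_map] at key
  simp only [splitValue, hr, one_div]
  exact key

theorem pos_iff_esymm_pos (hβ : Antitone β) (hβ0 : ∀ i, 0 ≤ β i) (i : Fin m) :
    0 < β i ↔ 0 < (Finset.univ.val.map β).esymm (i + 1) := by
  rw [Finset.esymm_map_val]
  constructor
  · refine fun hi => Finset.sum_pos' (fun U _ => Finset.prod_nonneg fun j _ => hβ0 j)
      ⟨Finset.Iic i, ?_, Finset.prod_pos fun j hj => hi.trans_le (hβ (Finset.mem_Iic.1 hj))⟩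
    simp
  · intro h
    obtain ⟨U, hU, hprod⟩ := Finset.exists_ne_zero_of_sum_ne_zero h.ne'
    obtain ⟨j, hj, hij⟩ : ∃ j ∈ U, i ≤ j := by
      by_contra! hlt
      have hcard := Finset.card_le_card (fun j hj => Finset.mem_Iio.2 (hlt j hj) : U ⊆ .Iio i)
      rw [(Finset.mem_powersetCard.1 hU).2, Fin.card_Iio] at hcard
      omega
    exact ((hβ0 j).lt_of_ne' (Finset.prod_ne_zero_iff.1 hprod j hj)).trans_le (hβ hij)

theorem phi_ite {d : ℕ} {p q : ℝ} (hd : d < k) (hkm : k ≤ m) (hq : 0 ≤ q)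
    (hpq : ((m : ℝ) - d) * q < (k - d) * p) :
    phi k (fun i : Fin m => if (i : ℕ) < d then p else q) =
      d / p + ((k : ℝ) - d) ^ 2 / ((m - d) * q) := by
  have hdk : (0 : ℝ) < k - d := by
    rw [sub_pos]
    exact_mod_cast hd
  have hkm' : (k : ℝ) ≤ m := by exact_mod_cast hkm
  have hqp : q ≤ p := by nlinarith
  set β : Fin m → ℝ := fun i => if (i : ℕ) < d then p else q
  have hβ : Antitone β := by
    intro i j hij
    have : (i : ℕ) ≤ j := hij
    dsimp only [β]
    split_ifs <;> first | omega | linarith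
  have hβ0 : ∀ i, 0 ≤ β i := fun i => by
    dsimp only [β]
    split_ifs <;> linarith
  have hT : ∑ j ∈ Finset.univ.filter (fun j : Fin m => d ≤ (j : ℕ)), β j = (m - d) * q := by
    have hcard : (Finset.univ.filter fun j : Fin m => d ≤ (j : ℕ)).card = m - d := by
      simp only [← not_lt]
      rw [← Finset.compl_filter, Finset.card_compl, Fintype.card_fin, Fin.card_filter_val_lt,
        min_eq_right (hd.le.trans hkm)]
    rw [Finset.sum_congr rfl fun j hj => if_neg (not_lt.2 (Finset.mem_filter.1 hj).2),
      Finset.sum_const, hcard, nsmul_eq_mul, Nat.cast_sub (hd.le.trans hkm)]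
  have hsplit : splitIndex k β = d := by
    refine splitIndex_eq hkm hβ hβ0 ⟨hd, fun i hi => ?_, fun i hi => ?_⟩ <;> rw [hT]
    · rw [div_lt_iff₀ hdk]
      simpa [β, show (i : ℕ) < d by omega, mul_comm] using hpq
    · rw [le_div_iff₀ hdk]
      simp only [β, hi, lt_irrefl, if_false]
      nlinarith
  have hhead : ∑ i ∈ Finset.univ.filter (fun i : Fin m => (i : ℕ) < d), 1 / β i = d / p := by
    have hβ : ∀ i ∈ Finset.univ.filter (fun i : Fin m => (i : ℕ) < d), 1 / β i = 1 / p :=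
      fun i hi => congrArg _ (if_pos (Finset.mem_filter.1 hi).2)
    rw [Finset.sum_congr rfl hβ, Finset.sum_const, Fin.card_filter_val_lt,
      min_eq_right (hd.le.trans hkm), nsmul_eq_mul, mul_one_div]
  rw [phi, hsplit, hT, hhead]

theorem isClosed_setOf_isWeakSplitIndex (k ι : ℕ) :
    IsClosed {β : Fin m → ℝ | IsWeakSplitIndex k β ι} := by
  have hT : Continuous fun β : Fin m → ℝ => tailSum ι β := by
    unfold tailSum
    fun_prop
  refine isClosed_const.inter ((?_ : IsClosed {β : Fin m → ℝ | _}).inter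
    (?_ : IsClosed {β : Fin m → ℝ | _}))
  · simp only [Set.ofPred_forall]
    exact isClosed_iInter fun i => isClosed_iInter fun _ =>
      isClosed_le (hT.div_const _) (continuous_apply i)
  · simp only [Set.ofPred_forall]
    exact isClosed_iInter fun i => isClosed_iInter fun _ =>
      isClosed_le (continuous_apply i) (hT.div_const _)

theorem continuousOn_splitValue (hkm : k ≤ m) (hι : ι < k) :
    ContinuousOn (splitValue k ι) (phiDomain m k) := by
  unfold splitValue
  refine .add (continuousOn_finsetSum _ fun i hi => ?_) ?_
  · refine continuousOn_const.div (continuous_apply i).continuousOn fun β hβ => ?_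
    exact (hβ.2.2 i ((Finset.mem_filter.1 hi).2.trans hι)).ne'
  · refine continuousOn_const.div (Continuous.continuousOn ?_) fun β hβ => ?_
    · unfold tailSum
      fun_prop
    · exact (tailSum_pos hβ hι hkm).ne'

theorem continuousOn_phi (hk : 1 ≤ k) (hkm : k ≤ m) : ContinuousOn (phi k) (phiDomain m k) := by
  rw [continuousOn_iff_continuous_domRestrict]
  let piece (ι : Fin k) : Set (phiDomain m k) := {β | IsWeakSplitIndex k (β : Fin m → ℝ) ι}
  refine (locallyFinite_of_finite piece).continuous ?_ (fun ι => ?_) fun ι => ?_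
  · refine Set.eq_univ_of_forall fun β => Set.mem_iUnion.2 ?_
    have h := isSplitIndex_splitIndex hk hkm β.2.1 β.2.2.1
    exact ⟨⟨_, h.1⟩, h.isWeakSplitIndex⟩
  · exact (isClosed_setOf_isWeakSplitIndex k ι).preimage continuous_subtype_val
  · exact ((continuousOn_splitValue hkm ι.2).domRestrict.continuousOn).congr
      fun β hβ => phi_eq_splitValue hkm β.2 hβ

end SplitIndex

section PrincipalMinor

variable {ι R : Type*} [CommRing R]

/-- The determinant of the submatrix of `M` with rows and columns in `S`. -/
def principalMinor [DecidableEq ι] (M : Matrix ι ι R) (S : Finset ι) : R :=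
  (M.submatrix (Subtype.val : S → ι) (Subtype.val : S → ι)).det

theorem principalMinor_diagonal_mul [Fintype ι] [DecidableEq ι] (M : Matrix ι ι R) (x : ι → R)
    (S : Finset ι) :
    principalMinor (diagonal x * M) S = (∏ i ∈ S, x i) * principalMinor M S := by
  rw [← Finset.prod_coe_sort S x, principalMinor, principalMinor, ← det_diagonal, ← det_mul]
  congr 1
  ext i j
  simp [diagonal_mul]

theorem principalMinor_pos [DecidableEq ι] {M : Matrix ι ι ℝ} (hM : M.PosDef) (S : Finset ι) :
    0 < principalMinor M S :=
  (hM.submatrix Subtype.val_injective).det_pos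

end PrincipalMinor

section SortedSpectrum

variable {ι : Type*} [Fintype ι] [DecidableEq ι] {m : ℕ} {M : Matrix ι ι ℝ} {β γ : Fin m → ℝ}

/-- `β` lists the eigenvalues of `M`, with multiplicity, in nonincreasing order. The length `m` is
not tied definitionally to the size of `M`, which avoids the `Fin (Fintype.card ι)` of
`Matrix.IsHermitian.eigenvalues₀`. -/
structure IsSortedSpectrum (M : Matrix ι ι ℝ) (β : Fin m → ℝ) : Prop where
  antitone : Antitone β
  charpoly_eq : M.charpoly = ∏ i, (Polynomial.X - Polynomial.C (β i))

namespace IsSortedSpectrum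

theorem card_eq (h : IsSortedSpectrum M β) : Fintype.card ι = m := by
  rw [← M.charpoly_natDegree_eq_dim, h.charpoly_eq, Polynomial.natDegree_finsetProd_X_sub_C_eq_card]
  simp

theorem charpoly_eq_multiset_prod (h : IsSortedSpectrum M β) :
    M.charpoly =
      ((Finset.univ.val.map β).map fun b => Polynomial.X - Polynomial.C b).prod := by
  rw [h.charpoly_eq, Multiset.map_map]
  rfl

theorem roots_charpoly (h : IsSortedSpectrum M β) :
    M.charpoly.roots = Finset.univ.val.map β := by
  rw [h.charpoly_eq_multiset_prod, Polynomial.roots_multiset_prod_X_sub_C]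

theorem unique (hβ : IsSortedSpectrum M β) (hγ : IsSortedSpectrum M γ) : β = γ := by
  have h := hβ.roots_charpoly.symm.trans hγ.roots_charpoly
  rw [Fin.univ_val_map, Fin.univ_val_map, Multiset.coe_eq_coe] at h
  exact List.ofFn_injective
    (h.eq_of_sortedGE hβ.antitone.sortedGE_ofFn hγ.antitone.sortedGE_ofFn)

theorem nonneg (h : IsSortedSpectrum M β) (hM : M.PosSemidef) (i : Fin m) : 0 ≤ β i := by
  have hi : β i ∈ Finset.univ.val.map β := Multiset.mem_map_of_mem β (Finset.mem_univ_val i)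
  rw [← h.roots_charpoly, hM.isHermitian.roots_charpoly_eq_eigenvalues] at hi
  obtain ⟨j, -, hj⟩ := Multiset.mem_map.1 hi
  exact hj ▸ hM.eigenvalues_nonneg j

theorem sum_eq_trace (h : IsSortedSpectrum M β) : ∑ i, β i = M.trace := by
  have hsplits : M.charpoly.Splits :=
    h.charpoly_eq ▸ Polynomial.Splits.prod fun i _ => Polynomial.Splits.X_sub_C _
  rw [trace_eq_sum_roots_charpoly_of_splits hsplits, h.roots_charpoly]
  rfl

theorem esymm_eq_sum_principalMinor (h : IsSortedSpectrum M β) {j : ℕ} (hj : j ≤ m) :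
    (Finset.univ.val.map β).esymm j = ∑ S ∈ Finset.univ.powersetCard j, principalMinor M S := by
  have hminors := charpoly_coeff_eq_sum_minors M j (h.card_eq ▸ hj)
  have hvieta := Multiset.prod_X_sub_C_coeff (Finset.univ.val.map β) (k := m - j) (by simp)
  rw [h.card_eq, h.charpoly_eq_multiset_prod, hvieta] at hminors
  simp only [Multiset.card_map, Finset.card_val, Finset.card_univ, Fintype.card_fin,
    Nat.sub_sub_self hj] at hminors
  exact mul_left_cancel₀ (pow_ne_zero j (neg_ne_zero.2 one_ne_zero)) hminors

end IsSortedSpectrum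

theorem isSortedSpectrum_eigenvalues₀ (hM : M.IsHermitian) :
    IsSortedSpectrum M hM.eigenvalues₀ where
  antitone := hM.eigenvalues₀_antitone
  charpoly_eq := by
    rw [hM.charpoly_eq]
    exact Equiv.prod_comp (Fintype.equivOfCardEq (Fintype.card_fin _)).symm
      fun i => Polynomial.X - Polynomial.C (hM.eigenvalues₀ i)

theorem exists_isSortedSpectrum (hM : M.IsHermitian) (hm : Fintype.card ι = m) :
    ∃ β : Fin m → ℝ, IsSortedSpectrum M β := by
  subst hm
  exact ⟨_, isSortedSpectrum_eigenvalues₀ hM⟩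

theorem Phi_eq_phi {n : ℕ} (k : ℕ) {Y : Matrix (Fin n) (Fin n) ℝ} (hY : Y.PosSemidef)
    (hβ : IsSortedSpectrum Y β) : Phi k Y hY = phi k β := by
  obtain rfl := hβ.card_eq
  rw [Phi, (isSortedSpectrum_eigenvalues₀ hY.isHermitian).unique hβ]

theorem isClosed_setOf_isSortedSpectrum :
    IsClosed {p : Matrix ι ι ℝ × (Fin m → ℝ) | IsSortedSpectrum p.1 p.2} := by
  have hcharpoly (p : Matrix ι ι ℝ × (Fin m → ℝ)) :
      p.1.charpoly = ∏ i, (Polynomial.X - Polynomial.C (p.2 i)) ↔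
        ∀ t : ℝ, (scalar ι t - p.1).det = ∏ i, (t - p.2 i) := by
    constructor
    · intro h t
      simpa [eval_charpoly, Polynomial.eval_prod] using congrArg (Polynomial.eval t) h
    · exact fun h => Polynomial.funext fun t => by
        simpa [eval_charpoly, Polynomial.eval_prod] using h t
  have hset : {p : Matrix ι ι ℝ × (Fin m → ℝ) | IsSortedSpectrum p.1 p.2} =
      {p | Antitone p.2} ∩ ⋂ t : ℝ, {p | (scalar ι t - p.1).det = ∏ i, (t - p.2 i)} := by
    ext p
    simp only [Set.mem_inter_iff, Set.mem_iInter, Set.mem_ofPred_eq, ← hcharpoly]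
    exact ⟨fun h => ⟨h.1, h.2⟩, fun h => ⟨h.1, h.2⟩⟩
  rw [hset]
  exact (isClosed_antitone.preimage continuous_snd).inter <| isClosed_iInter fun t =>
    isClosed_eq (continuous_const.sub continuous_fst).matrix_det (by fun_prop)

theorem isCompact_setOf_isSortedSpectrum {K : Set (Matrix ι ι ℝ)} (hK : IsCompact K)
    (hpos : ∀ M ∈ K, M.PosSemidef) :
    IsCompact {β : Fin m → ℝ | ∃ M ∈ K, IsSortedSpectrum M β} := by
  obtain ⟨c, hc⟩ := hK.bddAbove_image (continuous_id.matrix_trace.continuousOn)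
  have hgraph : IsCompact ((K ×ˢ Set.Icc (0 : Fin m → ℝ) fun _ => c) ∩
      {p | IsSortedSpectrum p.1 p.2}) :=
    (hK.prod isCompact_Icc).inter_right isClosed_setOf_isSortedSpectrum
  convert hgraph.image continuous_snd using 1
  ext β
  constructor
  · rintro ⟨M, hM, hβ⟩
    have hβ0 := hβ.nonneg (hpos M hM)
    refine ⟨(M, β), ⟨⟨hM, hβ0, fun i => ?_⟩, hβ⟩, rfl⟩
    calc β i ≤ ∑ j, β j := Finset.single_le_sum (fun j _ => hβ0 j) (Finset.mem_univ i)
      _ = M.trace := hβ.sum_eq_trace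
      _ ≤ c := hc ⟨M, hM, rfl⟩
  · rintro ⟨⟨M, β⟩, ⟨⟨hM, -⟩, hβ⟩, rfl⟩
    exact ⟨M, hM, hβ⟩

end SortedSpectrum

section Hypersimplex

theorem prod_indicator_one {ι : Type*} [DecidableEq ι] (S T : Finset ι) :
    ∏ i ∈ T, Set.indicator (S : Set ι) (1 : ι → ℝ) i = if T ⊆ S then 1 else 0 := by
  simp [Set.indicator_apply, Finset.prod_ite_zero, Finset.subset_iff]

variable {ι : Type*} [Fintype ι] {k : ℕ} {x : ι → ℝ}

/-- The polytope `{x ∈ [0, 1]^ι | ∑ x_i = k}`, the feasible set of the relaxation. -/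
def hypersimplex (ι : Type*) [Fintype ι] (k : ℕ) : Set (ι → ℝ) :=
  {x | (∀ i, x i ∈ Set.Icc (0 : ℝ) 1) ∧ ∑ i, x i = k}

theorem isCompact_hypersimplex : IsCompact (hypersimplex ι k) := by
  have hcube : IsCompact {x : ι → ℝ | ∀ i, x i ∈ Set.Icc (0 : ℝ) 1} :=
    isCompact_pi_infinite fun _ => isCompact_Icc
  exact hcube.inter_right (isClosed_eq (by fun_prop) continuous_const)

theorem indicator_mem_hypersimplex (S : Finset ι) :
    Set.indicator (S : Set ι) 1 ∈ hypersimplex ι S.card := by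
  classical
  refine ⟨fun i => ?_, by simp [Finset.sum_indicator_eq_sum_inter]⟩
  by_cases hi : i ∈ S <;> simp [hi]

theorem le_card_support (hx : x ∈ hypersimplex ι k) :
    k ≤ (Finset.univ.filter fun i => 0 < x i).card := by
  set support := Finset.univ.filter fun i => 0 < x i
  have h : (k : ℝ) ≤ support.card :=
    calc (k : ℝ) = ∑ i ∈ support, x i := by
          rw [← hx.2]
          exact (Finset.sum_filter_of_ne fun i _ hi => (hx.1 i).1.lt_of_ne' hi).symm
      _ ≤ support.card • (1 : ℝ) := Finset.sum_le_card_nsmul _ _ _ fun i _ => (hx.1 i).2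
      _ = support.card := nsmul_one _
  exact_mod_cast h

variable [DecidableEq ι]

theorem sum_prod_mul_principalMinor_pos {M : Matrix ι ι ℝ} (hM : M.PosDef)
    (hx : x ∈ hypersimplex ι k) {j : ℕ} (hj : j ≤ k) :
    0 < ∑ S ∈ Finset.univ.powersetCard j, (∏ i ∈ S, x i) * principalMinor M S := by
  obtain ⟨S, hS, hcard⟩ := Finset.exists_subset_card_eq (hj.trans (le_card_support hx))
  refine Finset.sum_pos' (fun T _ => mul_nonneg (Finset.prod_nonneg fun i _ => (hx.1 i).1)
    (principalMinor_pos hM T).le) ⟨S, by simp [hcard], ?_⟩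
  exact mul_pos (Finset.prod_pos fun i hi => (Finset.mem_filter.1 (hS hi)).2)
    (principalMinor_pos hM S)

theorem sum_prod_indicator_mul_principalMinor (M : Matrix ι ι ℝ) (S : Finset ι) (j : ℕ) :
    ∑ T ∈ Finset.univ.powersetCard j,
        (∏ i ∈ T, Set.indicator (S : Set ι) (1 : ι → ℝ) i) * principalMinor M T =
      ∑ T ∈ S.powersetCard j, principalMinor M T := by
  have hfilter : (Finset.univ.powersetCard j).filter (· ⊆ S) = S.powersetCard j := by
    ext T
    simp [Finset.mem_powersetCard, and_comm]
  simp only [prod_indicator_one, ite_mul, one_mul, zero_mul, ← hfilter, Finset.sum_filter]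

end Hypersimplex

section Relaxation

variable {n k : ℕ} {H : Matrix (Fin n) (Fin n) ℝ} {x : Fin n → ℝ} {β : Fin n → ℝ}

theorem weightedSum_eq (H : Matrix (Fin n) (Fin n) ℝ) (x : Fin n → ℝ) :
    weightedSum H x = H * diagonal x * Hᵀ := by
  ext i j
  rw [weightedSum, Matrix.sum_apply, mul_apply]
  refine Finset.sum_congr rfl fun l _ => ?_
  rw [Matrix.smul_apply, vecMulVec_apply, mul_diagonal, transpose_apply, smul_eq_mul,
    mul_right_comm, mul_comm]
  rfl

theorem charpoly_weightedSum (H : Matrix (Fin n) (Fin n) ℝ) (x : Fin n → ℝ) :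
    (weightedSum H x).charpoly = (diagonal x * (Hᵀ * H)).charpoly := by
  rw [weightedSum_eq, Matrix.mul_assoc, charpoly_mul_comm, Matrix.mul_assoc]

theorem esymm_eq_sum_prod_mul_principalMinor (hβ : IsSortedSpectrum (weightedSum H x) β) {j : ℕ}
    (hj : j ≤ n) :
    (Finset.univ.val.map β).esymm j =
      ∑ S ∈ Finset.univ.powersetCard j, (∏ i ∈ S, x i) * principalMinor (Hᵀ * H) S := by
  have hβ' : IsSortedSpectrum (diagonal x * (Hᵀ * H)) β :=
    ⟨hβ.antitone, charpoly_weightedSum H x ▸ hβ.charpoly_eq⟩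
  simp only [hβ'.esymm_eq_sum_principalMinor hj, principalMinor_diagonal_mul]

theorem mem_phiDomain (hH : (Hᵀ * H).PosDef) (hx : x ∈ hypersimplex (Fin n) k)
    (hβ : IsSortedSpectrum (weightedSum H x) β) : β ∈ phiDomain n k := by
  have hβ0 := hβ.nonneg (weightedSum_posSemidef H hx.1)
  refine ⟨hβ.antitone, hβ0, fun i hi => ?_⟩
  rw [pos_iff_esymm_pos hβ.antitone hβ0, esymm_eq_sum_prod_mul_principalMinor hβ i.2]
  exact sum_prod_mul_principalMinor_pos hH hx hi

/-- The sorted spectra of the feasible matrices `∑ x_i h_i h_iᵀ` of the relaxation. -/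
def relaxationSpectra (H : Matrix (Fin n) (Fin n) ℝ) (k : ℕ) : Set (Fin n → ℝ) :=
  {β | ∃ x ∈ hypersimplex (Fin n) k, IsSortedSpectrum (weightedSum H x) β}

theorem relaxationSpectra_subset_phiDomain (hH : (Hᵀ * H).PosDef) :
    relaxationSpectra H k ⊆ phiDomain n k :=
  fun _ ⟨_, hx, hβ⟩ => mem_phiDomain hH hx hβ

theorem isCompact_relaxationSpectra (H : Matrix (Fin n) (Fin n) ℝ) (k : ℕ) :
    IsCompact (relaxationSpectra H k) := by
  have hfeasible : IsCompact (weightedSum H '' hypersimplex (Fin n) k) :=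
    isCompact_hypersimplex.image (by unfold weightedSum; fun_prop)
  have hpos : ∀ M ∈ weightedSum H '' hypersimplex (Fin n) k, M.PosSemidef := by
    rintro _ ⟨x, hx, rfl⟩
    exact weightedSum_posSemidef H hx.1
  simpa only [relaxationSpectra, Set.exists_mem_image] using
    isCompact_setOf_isSortedSpectrum (m := n) hfeasible hpos

theorem exists_isSortedSpectrum_weightedSum (H : Matrix (Fin n) (Fin n) ℝ)
    (hx : x ∈ hypersimplex (Fin n) k) : ∃ β : Fin n → ℝ, IsSortedSpectrum (weightedSum H x) β :=
  exists_isSortedSpectrum (weightedSum_posSemidef H hx.1).isHermitian (Fintype.card_fin n)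

theorem relaxationSpectra_nonempty (H : Matrix (Fin n) (Fin n) ℝ) (hkn : k ≤ n) :
    (relaxationSpectra H k).Nonempty := by
  obtain ⟨S, -, rfl⟩ := Finset.exists_subset_card_eq (s := (Finset.univ : Finset (Fin n)))
    (by simpa using hkn)
  obtain ⟨β, hβ⟩ := exists_isSortedSpectrum_weightedSum H (indicator_mem_hypersimplex S)
  exact ⟨β, _, indicator_mem_hypersimplex S, hβ⟩

variable {d : ℕ} (a : Fin n → Fin d → ℝ) {lam : ℝ} (hlam : 0 < lam)

theorem posDef_transpose_cholesky_mul_self {C : Matrix (Fin n) (Fin n) ℝ} (hC : C.PosDef) :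
    ((cholesky hC)ᵀ * cholesky hC).PosDef := by
  rwa [cholesky_transpose_mul_self]

theorem relaxationValues_eq_image :
    relaxationValues a hlam k = (fun β => phi k β + ((d : ℝ) - k) / lam) ''
      relaxationSpectra (cholesky (covMatrix_posDef a hlam)) k := by
  ext v
  constructor
  · rintro ⟨x, hx, hsum, rfl⟩
    obtain ⟨β, hβ⟩ := exists_isSortedSpectrum_weightedSum
      (cholesky (covMatrix_posDef a hlam)) ⟨hx, hsum⟩
    exact ⟨β, ⟨x, ⟨hx, hsum⟩, hβ⟩, by rw [Phi_eq_phi k _ hβ]⟩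
  · rintro ⟨β, ⟨x, ⟨hx, hsum⟩, hβ⟩, rfl⟩
    exact ⟨x, hx, hsum, by rw [Phi_eq_phi k _ hβ]⟩

theorem isLeast_nuM (hk : 1 ≤ k) (hkn : k ≤ n) :
    IsLeast (relaxationValues a hlam k) (nuM a hlam k) := by
  have hdomain : relaxationSpectra (cholesky (covMatrix_posDef a hlam)) k ⊆ phiDomain n k :=
    relaxationSpectra_subset_phiDomain (posDef_transpose_cholesky_mul_self _)
  rw [nuM, relaxationValues_eq_image]
  exact ((isCompact_relaxationSpectra _ k).image_of_continuousOn
    (((continuousOn_phi hk hkn).mono hdomain).add continuousOn_const)).isLeast_sInf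
      ((relaxationSpectra_nonempty _ hkn).image _)

theorem isLeast_z (lam : ℝ) (hkn : k ≤ n) : IsLeast (designValues a lam k) (z a lam k) := by
  have hvalues : designValues a lam k = objective a lam '' {S | S.card = k} := by
    ext v
    exact exists_congr fun S => and_congr_right fun _ => eq_comm
  rw [z, hvalues]
  refine ((Set.toFinite _).image _).isCompact.isLeast_sInf (.image _ ?_)
  obtain ⟨S, -, hS⟩ := Finset.exists_subset_card_eq (s := (Finset.univ : Finset (Fin n)))
    (by simpa using hkn)
  exact ⟨S, hS⟩

end Relaxation

section ResolventTrace

variable {ι κ : Type*} [Fintype ι]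

theorem posDef_transpose_mul_self_add_smul_one [Finite κ] [DecidableEq κ] (A : Matrix ι κ ℝ)
    {c : ℝ} (hc : 0 < c) :
    (Aᵀ * A + c • 1).PosDef :=
  PosDef.posSemidef_add (by simpa using posSemidef_conjTranspose_mul_self A) (PosDef.one.smul hc)

variable [Fintype κ] [DecidableEq ι]

section Field

variable [DecidableEq κ] {K : Type*} [Field K] {U : Matrix ι κ K} {V : Matrix κ ι K} {c : K}

theorem inv_mul_add_smul_one (hc : c ≠ 0) (hG : IsUnit (V * U + c • 1).det) :
    (U * V + c • 1)⁻¹ = c⁻¹ • (1 - U * (V * U + c • 1)⁻¹ * V) := by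
  have hcomm : (U * V + c • 1) * U = U * (V * U + c • 1) := by
    simp only [Matrix.add_mul, Matrix.mul_add, Matrix.mul_assoc, Matrix.smul_mul, Matrix.mul_smul,
      Matrix.one_mul, Matrix.mul_one]
  refine inv_eq_right_inv ?_
  calc (U * V + c • 1) * (c⁻¹ • (1 - U * (V * U + c • 1)⁻¹ * V))
      = c⁻¹ • (U * V + c • 1 - (U * V + c • 1) * U * (V * U + c • 1)⁻¹ * V) := by
        rw [Matrix.mul_smul, Matrix.mul_sub, Matrix.mul_one, ← Matrix.mul_assoc, ← Matrix.mul_assoc]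
    _ = c⁻¹ • (U * V + c • 1 - U * V) := by rw [hcomm, mul_nonsing_inv_cancel_right _ _ hG]
    _ = 1 := by rw [add_sub_cancel_left, inv_smul_smul₀ hc]

theorem trace_inv_mul_add_smul_one (hc : c ≠ 0) (hG : IsUnit (V * U + c • 1).det) :
    (U * V + c • 1)⁻¹.trace =
      (V * U + c • 1)⁻¹.trace + ((Fintype.card ι : K) - Fintype.card κ) / c := by
  have hcyc : (U * (V * U + c • 1)⁻¹ * V).trace =
      Fintype.card κ - c * (V * U + c • 1)⁻¹.trace := by
    calc (U * (V * U + c • 1)⁻¹ * V).trace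
        = ((V * U + c • 1 - c • 1) * (V * U + c • 1)⁻¹).trace := by
          rw [trace_mul_comm, ← Matrix.mul_assoc, add_sub_cancel_right]
      _ = Fintype.card κ - c * (V * U + c • 1)⁻¹.trace := by
          rw [Matrix.sub_mul, mul_nonsing_inv _ hG, Matrix.smul_mul, Matrix.one_mul, trace_sub,
            trace_one, trace_smul, smul_eq_mul]
  rw [inv_mul_add_smul_one hc hG, trace_smul, trace_sub, trace_one, hcyc, smul_eq_mul]
  field_simp
  ring

end Field

theorem trace_inv_mul_transpose_add_smul_one_le (A : Matrix ι κ ℝ) {c : ℝ} (hc : 0 < c) :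
    (A * Aᵀ + c • 1)⁻¹.trace ≤ Fintype.card ι / c := by
  classical
  have hG := posDef_transpose_mul_self_add_smul_one A hc
  have hpos : 0 ≤ (A * (Aᵀ * A + c • 1)⁻¹ * Aᵀ).trace := by
    simpa using (hG.inv.posSemidef.mul_mul_conjTranspose_same A).trace_nonneg
  rw [inv_mul_add_smul_one hc.ne' hG.det_pos.ne'.isUnit, trace_smul, trace_sub, trace_one,
    smul_eq_mul, inv_mul_eq_div]
  gcongr
  linarith

end ResolventTrace

section Objective

variable {d n : ℕ} (a : Fin n → Fin d → ℝ) (lam : ℝ) (S : Finset (Fin n))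

/-- The `d × S` matrix whose columns are the selected vectors `a i`, `i ∈ S`. -/
def selectedColumns : Matrix (Fin d) S ℝ :=
  (designMatrix a).submatrix id Subtype.val

theorem objective_eq_trace_inv :
    objective a lam S = (selectedColumns a S * (selectedColumns a S)ᵀ + lam • 1)⁻¹.trace := by
  have hgram : ∑ i ∈ S, vecMulVec (a i) (a i) =
      selectedColumns a S * (selectedColumns a S)ᵀ := by
    ext j l
    simp only [Matrix.sum_apply, mul_apply]
    exact (Finset.sum_coe_sort S fun i => vecMulVec (a i) (a i) j l).symm
  rw [objective, hgram]

theorem covMatrix_submatrix :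
    (covMatrix a lam).submatrix (Subtype.val : S → Fin n) Subtype.val =
      (selectedColumns a S)ᵀ * selectedColumns a S + lam • 1 := by
  rw [← submatrix_one (Subtype.val : S → Fin n) Subtype.val_injective]
  rfl

variable {lam}

theorem objective_eq_trace_inv_covMatrix (hlam : 0 < lam) :
    objective a lam S =
      ((covMatrix a lam).submatrix (Subtype.val : S → Fin n) Subtype.val)⁻¹.trace +
        ((d : ℝ) - S.card) / lam := by
  have hG := posDef_transpose_mul_self_add_smul_one (selectedColumns a S) hlam
  rw [objective_eq_trace_inv, trace_inv_mul_add_smul_one hlam.ne' hG.det_pos.ne'.isUnit,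
    covMatrix_submatrix, Fintype.card_fin, Fintype.card_coe]

theorem objective_le (hlam : 0 < lam) : objective a lam S ≤ d / lam := by
  simpa [objective_eq_trace_inv] using
    trace_inv_mul_transpose_add_smul_one_le (selectedColumns a S) hlam

end Objective

section Cofactor

variable {ι R : Type*} [DecidableEq ι] [CommRing R]

theorem principalMinor_univ_erase [Fintype ι] (M : Matrix ι ι R) (i : ι) :
    principalMinor M (Finset.univ.erase i) = M.adjugate i i := by
  rw [adjugate_apply, principalMinor, ← det_piecewise_one_eq_submatrix_det]
  congr 1
  ext j l
  by_cases hj : j = i <;> simp [hj, updateRow_apply, one_eq_pi_single]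

theorem principalMinor_submatrix {κ : Type*} [DecidableEq κ] (M : Matrix ι ι R) (f : κ ↪ ι)
    (T : Finset κ) : principalMinor (M.submatrix f f) T = principalMinor M (T.map f) := by
  rw [principalMinor, principalMinor, ← det_submatrix_equiv_self (T.equivMap f)]
  rfl

theorem sum_principalMinor_erase {M : Matrix ι ι R} {S : Finset ι}
    (hS : IsUnit (principalMinor M S)) :
    ∑ i ∈ S, principalMinor M (S.erase i) =
      principalMinor M S * (M.submatrix (Subtype.val : S → ι) Subtype.val)⁻¹.trace := by
  set N := M.submatrix (Subtype.val : S → ι) Subtype.val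
  have hminor (i : S) : principalMinor M (S.erase i) = N.adjugate i i := by
    rw [← principalMinor_univ_erase]
    refine .trans ?_ (principalMinor_submatrix M (.subtype (· ∈ S)) (Finset.univ.erase i)).symm
    rw [Finset.map_erase, Finset.univ_eq_attach, Finset.attach_map_val]
    rfl
  calc ∑ i ∈ S, principalMinor M (S.erase i) = N.adjugate.trace := by
        rw [← Finset.sum_coe_sort]
        exact Finset.sum_congr rfl fun i _ => hminor i
    _ = N.det * N⁻¹.trace := by
        rw [inv_def, trace_smul, smul_eq_mul]
        exact (Ring.mul_inverse_cancel_left N.det _ hS).symm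

end Cofactor

section Integrality

variable {n : ℕ} {H : Matrix (Fin n) (Fin n) ℝ} {S : Finset (Fin n)} {β : Fin n → ℝ}

theorem sum_inv_mul_esymm {m r : ℕ} {β : Fin m → ℝ} (hrm : r < m)
    (hpos : ∀ i : Fin m, (i : ℕ) < r + 1 → β i ≠ 0)
    (hzero : ∀ i : Fin m, r + 1 ≤ (i : ℕ) → β i = 0) :
    (∑ i ∈ Finset.univ.filter (fun i : Fin m => (i : ℕ) < r + 1), (β i)⁻¹) *
        (Finset.univ.val.map β).esymm (r + 1) = (Finset.univ.val.map β).esymm r := by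
  set head := Finset.univ.filter fun i : Fin m => (i : ℕ) < r + 1
  have hcard : head.card = r + 1 := by
    rw [Fin.card_filter_val_lt, min_eq_right hrm]
  have hhead (j : ℕ) :
      (Finset.univ.val.map β).esymm j = ∑ U ∈ head.powersetCard j, ∏ i ∈ U, β i := by
    rw [Finset.esymm_map_val]
    refine (Finset.sum_subset (Finset.powersetCard_mono (Finset.subset_univ _)) ?_).symm
    intro U hU hU'
    rw [Finset.mem_powersetCard] at hU hU'
    obtain ⟨i, hiU, hi⟩ := Finset.not_subset.1 fun h => hU' ⟨h, hU.2⟩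
    exact Finset.prod_eq_zero hiU (hzero i (by simpa [head] using hi))
  have hself : head.powersetCard (r + 1) = {head} := hcard ▸ Finset.powersetCard_self head
  rw [hhead, hhead, hself, Finset.sum_singleton, sum_powersetCard_eq_sum_erase hcard,
    Finset.sum_mul]
  refine Finset.sum_congr rfl fun i hi => ?_
  rw [← Finset.mul_prod_erase head β hi,
    inv_mul_cancel_left₀ (hpos i (Finset.mem_filter.1 hi).2)]

theorem esymm_indicator (hβ : IsSortedSpectrum (weightedSum H (Set.indicator S 1)) β) {j : ℕ}
    (hj : j ≤ n) :
    (Finset.univ.val.map β).esymm j = ∑ T ∈ S.powersetCard j, principalMinor (Hᵀ * H) T := by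
  rw [esymm_eq_sum_prod_mul_principalMinor hβ hj, sum_prod_indicator_mul_principalMinor]

theorem eq_zero_of_card_le (hβ : IsSortedSpectrum (weightedSum H (Set.indicator S 1)) β)
    (i : Fin n) (hi : S.card ≤ i) : β i = 0 := by
  have hβ0 := hβ.nonneg (weightedSum_posSemidef H (indicator_mem_hypersimplex S).1)
  have hesymm : (Finset.univ.val.map β).esymm (i + 1) = 0 := by
    rw [esymm_indicator hβ i.2, Finset.powersetCard_eq_empty.2 (Nat.lt_succ_of_le hi),
      Finset.sum_empty]
  exact (hβ0 i).eq_of_not_lt' fun h =>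
    ((pos_iff_esymm_pos hβ.antitone hβ0 i).1 h).ne' hesymm

theorem sum_inv_eq_trace_inv (hH : (Hᵀ * H).PosDef) (hS : S.Nonempty)
    (hβ : IsSortedSpectrum (weightedSum H (Set.indicator S 1)) β) :
    ∑ i ∈ Finset.univ.filter (fun i : Fin n => (i : ℕ) < S.card), (β i)⁻¹ =
      ((Hᵀ * H).submatrix (Subtype.val : S → Fin n) Subtype.val)⁻¹.trace := by
  obtain ⟨r, hr⟩ : ∃ r, S.card = r + 1 := Nat.exists_eq_add_one.2 hS.card_pos
  have hrn : r + 1 ≤ n := by simpa [hr] using S.card_le_univ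
  have hmem := mem_phiDomain hH (indicator_mem_hypersimplex S) hβ
  have hminor := principalMinor_pos hH S
  have hself : S.powersetCard (r + 1) = {S} := hr ▸ Finset.powersetCard_self S
  have h := sum_inv_mul_esymm hrn (fun i hi => (hmem.2.2 i (hr ▸ hi)).ne')
    fun i hi => eq_zero_of_card_le hβ i (hr ▸ hi)
  rw [esymm_indicator hβ hrn, esymm_indicator hβ (Nat.le_of_succ_le hrn), hself,
    Finset.sum_singleton, sum_powersetCard_eq_sum_erase hr,
    sum_principalMinor_erase hminor.ne'.isUnit, mul_comm] at h
  rw [hr]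
  exact mul_left_cancel₀ hminor.ne' h

theorem phi_indicator_le_trace_inv (hH : (Hᵀ * H).PosDef) (hS : S.Nonempty)
    (hβ : IsSortedSpectrum (weightedSum H (Set.indicator S 1)) β) :
    phi S.card β ≤ ((Hᵀ * H).submatrix (Subtype.val : S → Fin n) Subtype.val)⁻¹.trace := by
  rw [← sum_inv_eq_trace_inv hH hS hβ]
  exact phi_le_sum_inv hS.card_pos (by simpa using S.card_le_univ)
    (mem_phiDomain hH (indicator_mem_hypersimplex S) hβ)

end Integrality

section VolumeSampling

theorem exists_le_of_sum_mul_le {σ K : Type*} [Field K] [LinearOrder K] [IsStrictOrderedRing K]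
    {s : Finset σ} {w f : σ → K} {c : K} (hw : ∀ i ∈ s, 0 ≤ w i) (hpos : 0 < ∑ i ∈ s, w i)
    (h : ∑ i ∈ s, w i * f i ≤ c * ∑ i ∈ s, w i) : ∃ i ∈ s, f i ≤ c := by
  by_contra! hlt
  obtain ⟨i, hi, hwi⟩ := Finset.exists_lt_of_sum_lt (f := fun _ => (0 : K)) (by simpa using hpos)
  refine h.not_gt ?_
  rw [Finset.mul_sum]
  refine Finset.sum_lt_sum (fun j hj => ?_) ⟨i, hi, ?_⟩
  · rw [mul_comm]
    exact mul_le_mul_of_nonneg_left (hlt j hj).le (hw j hj)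
  · rw [mul_comm]
    exact mul_lt_mul_of_pos_left (hlt i hi) hwi

theorem sum_prod_mul_sum_principalMinor_erase_le {ι : Type*} [Fintype ι] [DecidableEq ι]
    {C : Matrix ι ι ℝ} (hC : C.PosDef) {x : ι → ℝ} {r : ℕ} (hx : x ∈ hypersimplex ι (r + 1)) :
    ∑ S ∈ Finset.univ.powersetCard (r + 1),
        (∏ i ∈ S, x i) * ∑ i ∈ S, principalMinor C (S.erase i) ≤
      min ((r : ℝ) + 1) (Fintype.card ι - r) *
        ∑ T ∈ Finset.univ.powersetCard r, (∏ i ∈ T, x i) * principalMinor C T := by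
  have hexchange : ∑ S ∈ Finset.univ.powersetCard (r + 1),
        (∏ i ∈ S, x i) * ∑ i ∈ S, principalMinor C (S.erase i) =
      ∑ T ∈ Finset.univ.powersetCard r,
        (∑ i ∈ Finset.univ \ T, x i) * ((∏ j ∈ T, x j) * principalMinor C T) := by
    simp only [Finset.sum_mul, Finset.mul_sum]
    rw [sum_powersetCard_sum_sdiff Finset.univ r
      fun T i => x i * ((∏ j ∈ T, x j) * principalMinor C T)]
    refine Finset.sum_congr rfl fun S _ => Finset.sum_congr rfl fun i hi => ?_
    rw [← Finset.mul_prod_erase S x hi, mul_assoc]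
  rw [hexchange, Finset.mul_sum]
  refine Finset.sum_le_sum fun T hT => ?_
  refine mul_le_mul_of_nonneg_right (le_min ?_ ?_)
    (mul_nonneg (Finset.prod_nonneg fun i _ => (hx.1 i).1) (principalMinor_pos hC T).le)
  · calc ∑ i ∈ Finset.univ \ T, x i ≤ ∑ i, x i :=
          Finset.sum_le_sum_of_subset_of_nonneg Finset.sdiff_subset fun i _ _ => (hx.1 i).1
      _ = r + 1 := by rw [hx.2, Nat.cast_add_one]
  · have hT' := (Finset.mem_powersetCard.1 hT).2
    calc ∑ i ∈ Finset.univ \ T, x i ≤ (Finset.univ \ T).card • (1 : ℝ) :=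
          Finset.sum_le_card_nsmul _ _ _ fun i _ => (hx.1 i).2
      _ = Fintype.card ι - r := by
        rw [nsmul_one, Finset.card_sdiff_of_subset (Finset.subset_univ T), hT',
          Nat.cast_sub (hT' ▸ T.card_le_univ), Finset.card_univ]

variable {n k : ℕ} {H : Matrix (Fin n) (Fin n) ℝ} {β : Fin n → ℝ}

theorem exists_trace_inv_le_mul_phi (hH : (Hᵀ * H).PosDef) (hk : 1 ≤ k) (hkn : k ≤ n)
    (hβ : β ∈ relaxationSpectra H k) :
    ∃ S : Finset (Fin n), S.card = k ∧
      ((Hᵀ * H).submatrix (Subtype.val : S → Fin n) Subtype.val)⁻¹.trace ≤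
        min (k : ℝ) (n - k + 1) * phi k β := by
  obtain ⟨r, rfl⟩ := Nat.exists_eq_add_one.2 hk
  have hmem := relaxationSpectra_subset_phiDomain hH hβ
  obtain ⟨x, hx, hβ⟩ := hβ
  have hcap : min ((r : ℝ) + 1) (n - r) = min ((r + 1 : ℕ) : ℝ) (n - (r + 1 : ℕ) + 1) := by
    push_cast
    ring_nf
  have hcap0 : 0 ≤ min ((r + 1 : ℕ) : ℝ) (n - (r + 1 : ℕ) + 1) := by
    have : ((r + 1 : ℕ) : ℝ) ≤ n := by exact_mod_cast hkn
    exact le_min (Nat.cast_nonneg _) (by linarith)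
  have hphi := esymm_le_phi_mul_esymm hkn hmem
  rw [esymm_eq_sum_prod_mul_principalMinor hβ (Nat.le_of_succ_le hkn),
    esymm_eq_sum_prod_mul_principalMinor hβ hkn] at hphi
  have hsample := sum_prod_mul_sum_principalMinor_erase_le hH hx
  rw [Fintype.card_fin, hcap] at hsample
  obtain ⟨S, hS, hle⟩ := exists_le_of_sum_mul_le
    (w := fun S => (∏ i ∈ S, x i) * principalMinor (Hᵀ * H) S)
    (f := fun S => ((Hᵀ * H).submatrix (Subtype.val : S → Fin n) Subtype.val)⁻¹.trace)
    (c := min ((r + 1 : ℕ) : ℝ) (n - (r + 1 : ℕ) + 1) * phi (r + 1) β)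
    (fun S _ => mul_nonneg (Finset.prod_nonneg fun i _ => (hx.1 i).1) (principalMinor_pos hH S).le)
    (sum_prod_mul_principalMinor_pos hH hx le_rfl) <| by
      simp only [mul_assoc, ← sum_principalMinor_erase (principalMinor_pos hH _).ne'.isUnit]
      exact hsample.trans (mul_le_mul_of_nonneg_left hphi hcap0)
  exact ⟨S, (Finset.mem_powersetCard.1 hS).2, hle⟩

end VolumeSampling

section Bounds

variable {d n k : ℕ} (a : Fin n → Fin d → ℝ) {lam : ℝ} (hlam : 0 < lam)

theorem nuM_sub_pos (hk : 1 ≤ k) (hkn : k ≤ n) :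
    0 < nuM a hlam k - ((d : ℝ) - k) / lam := by
  have hmem := (isLeast_nuM a hlam hk hkn).1
  rw [relaxationValues_eq_image] at hmem
  obtain ⟨β, hβ, hν⟩ := hmem
  rw [← hν, add_sub_cancel_right]
  exact phi_pos hk hkn
    (relaxationSpectra_subset_phiDomain (posDef_transpose_cholesky_mul_self _) hβ)

theorem nuM_le_objective {S : Finset (Fin n)} (hS : S.Nonempty) :
    nuM a hlam S.card ≤ objective a lam S := by
  have hx := indicator_mem_hypersimplex S
  obtain ⟨β, hβ⟩ := exists_isSortedSpectrum_weightedSum (cholesky (covMatrix_posDef a hlam)) hx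
  have hphi := phi_indicator_le_trace_inv (posDef_transpose_cholesky_mul_self _) hS hβ
  rw [cholesky_transpose_mul_self] at hphi
  have hmem : phi S.card β + ((d : ℝ) - S.card) / lam ∈ relaxationValues a hlam S.card := by
    rw [relaxationValues_eq_image]
    exact ⟨β, ⟨_, hx, hβ⟩, rfl⟩
  calc nuM a hlam S.card ≤ phi S.card β + ((d : ℝ) - S.card) / lam :=
        (isLeast_nuM a hlam hS.card_pos (by simpa using S.card_le_univ)).2 hmem
    _ ≤ objective a lam S := by
        rw [objective_eq_trace_inv_covMatrix a S hlam]
        gcongr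

theorem nuM_le_z (hk : 1 ≤ k) (hkn : k ≤ n) : nuM a hlam k ≤ z a lam k := by
  obtain ⟨S, rfl, hz⟩ := (isLeast_z a lam hkn).1
  rw [hz]
  exact nuM_le_objective a hlam (Finset.card_pos.1 hk)

theorem z_sub_le_mul_nuM_sub (hk : 1 ≤ k) (hkn : k ≤ n) :
    z a lam k - ((d : ℝ) - k) / lam ≤
      min (k : ℝ) (n - k + 1) * (nuM a hlam k - ((d : ℝ) - k) / lam) := by
  have hmem := (isLeast_nuM a hlam hk hkn).1
  rw [relaxationValues_eq_image] at hmem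
  obtain ⟨β, hβ, hν⟩ := hmem
  obtain ⟨S, rfl, hS⟩ :=
    exists_trace_inv_le_mul_phi (posDef_transpose_cholesky_mul_self _) hk hkn hβ
  rw [cholesky_transpose_mul_self] at hS
  rw [← hν, add_sub_cancel_right]
  calc z a lam S.card - ((d : ℝ) - S.card) / lam
      ≤ objective a lam S - ((d : ℝ) - S.card) / lam :=
        sub_le_sub_right ((isLeast_z a lam hkn).2 ⟨S, rfl, rfl⟩) _
    _ ≤ _ := by rwa [objective_eq_trace_inv_covMatrix a S hlam, add_sub_cancel_right]

theorem z_le (hlam : 0 < lam) (hkn : k ≤ n) : z a lam k ≤ d / lam := by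
  obtain ⟨S, -, hz⟩ := (isLeast_z a lam hkn).1
  exact hz ▸ objective_le a S hlam

theorem nuM_pos (hk : 1 ≤ k) (hkn : k ≤ n) (hkd : k ≤ d) : 0 < nuM a hlam k := by
  have hkd' : (0 : ℝ) ≤ d - k := sub_nonneg.2 (Nat.cast_le.2 hkd)
  exact (div_nonneg hkd' hlam.le).trans_lt (sub_pos.1 (nuM_sub_pos a hlam hk hkn))

theorem one_le_z_div_nuM (hk : 1 ≤ k) (hkn : k ≤ n) (hkd : k ≤ d) :
    1 ≤ z a lam k / nuM a hlam k :=
  (one_le_div (nuM_pos a hlam hk hkn hkd)).2 (nuM_le_z a hlam hk hkn)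

theorem z_div_nuM_le_dim (hk : 1 ≤ k) (hkn : k ≤ n) (hkd : k ≤ d) :
    z a lam k / nuM a hlam k ≤ d / (d - k + 1) := by
  have hk' : (1 : ℝ) ≤ k := Nat.one_le_cast.2 hk
  have hkd' : (k : ℝ) ≤ d := Nat.cast_le.2 hkd
  have hpos := nuM_sub_pos a hlam hk hkn
  have hsample : z a lam k - ((d : ℝ) - k) / lam ≤ k * (nuM a hlam k - ((d : ℝ) - k) / lam) :=
    (z_sub_le_mul_nuM_sub a hlam hk hkn).trans
      (mul_le_mul_of_nonneg_right (min_le_left _ _) hpos.le)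
  have htrivial := z_le a hlam hkn
  rw [div_le_div_iff₀ (nuM_pos a hlam hk hkn hkd) (by linarith)]
  refine le_of_mul_le_mul_left ?_ (zero_lt_one.trans_le hk')
  rw [div_eq_mul_inv] at hsample htrivial
  have htrivial' := mul_le_mul_of_nonneg_left htrivial
    (mul_nonneg (sub_nonneg.2 hk') (sub_nonneg.2 hkd'))
  linear_combination (d : ℝ) * hsample + htrivial'

theorem div_sub_add_one_le_sub_one_div_sub {d k : ℝ} (hk : 1 ≤ k) (hkd : k < d) :
    d / (d - k + 1) ≤ (d - 1) / (d - k) := by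
  rw [div_le_div_iff₀ (by linarith) (by linarith)]
  linarith

theorem z_div_nuM_le_size (hk : 1 ≤ k) (hkn : k ≤ n) (hkd : k ≤ d) :
    z a lam k / nuM a hlam k ≤ n - k + 1 := by
  have hkn' : (k : ℝ) ≤ n := Nat.cast_le.2 hkn
  have hreg : 0 ≤ ((d : ℝ) - k) / lam := div_nonneg (sub_nonneg.2 (Nat.cast_le.2 hkd)) hlam.le
  have hsample := (z_sub_le_mul_nuM_sub a hlam hk hkn).trans
    (mul_le_mul_of_nonneg_right (min_le_right _ _) (nuM_sub_pos a hlam hk hkn).le)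
  rw [div_le_iff₀ (nuM_pos a hlam hk hkn hkd)]
  linarith [mul_nonneg (sub_nonneg.2 hkn') hreg]

end Bounds

section NegativeRelaxation

variable {d n k : ℕ}

/-- The vectors `a_i = n e_i` for `i ≤ d` and `a_i = 0` for `i > d`; for them the relaxation
value is negative as soon as `d < k < n`. -/
def scaledBasis (d n : ℕ) (i : Fin n) (l : Fin d) : ℝ :=
  if (i : ℕ) = l then n else 0

theorem covMatrix_scaledBasis (d n : ℕ) :
    covMatrix (scaledBasis d n) 1 =
      diagonal fun i : Fin n => if (i : ℕ) < d then (n : ℝ) ^ 2 + 1 else 1 := by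
  have hgram : (designMatrix (scaledBasis d n))ᵀ * designMatrix (scaledBasis d n) =
      diagonal fun i : Fin n => if (i : ℕ) < d then (n : ℝ) ^ 2 else 0 := by
    ext i j
    simp only [mul_apply, transpose_apply, designMatrix, of_apply, scaledBasis, diagonal_apply]
    split_ifs with hij hi
    · subst hij
      rw [Finset.sum_eq_single ⟨i, hi⟩ (fun l _ hl => ?_) (by simp)]
      · simp [sq]
      · rw [if_neg fun h => hl (Fin.ext h.symm), zero_mul]
    · refine Finset.sum_eq_zero fun l _ => ?_
      rw [if_neg fun h : (i : ℕ) = l => hi (h ▸ l.2), zero_mul]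
    · refine Finset.sum_eq_zero fun l _ => mul_eq_zero.2 ?_
      rcases eq_or_ne (i : ℕ) l with hi | hi
      · exact .inr (if_neg fun hj => hij (Fin.ext (hi.trans hj.symm)))
      · exact .inl (if_neg hi)
  rw [covMatrix, hgram, one_smul, ← diagonal_one, diagonal_add]
  congr 1
  ext i
  split_ifs <;> simp

theorem uniform_mem_hypersimplex (hn : 0 < n) (hkn : k ≤ n) :
    (fun _ => (k : ℝ) / n) ∈ hypersimplex (Fin n) k := by
  have hn' : (0 : ℝ) < n := Nat.cast_pos.2 hn
  refine ⟨fun _ => ⟨by positivity, (div_le_one hn').2 (Nat.cast_le.2 hkn)⟩, ?_⟩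
  rw [Finset.sum_const, Finset.card_univ, Fintype.card_fin, nsmul_eq_mul,
    mul_div_cancel₀ _ hn'.ne']

theorem scaledBasis_spectrum_mem_relaxationSpectra (d : ℕ) (hn : 0 < n) (hkn : k ≤ n) :
    (fun i : Fin n => if (i : ℕ) < d then (k : ℝ) / n * ((n : ℝ) ^ 2 + 1) else (k : ℝ) / n) ∈
      relaxationSpectra (cholesky (covMatrix_posDef (scaledBasis d n) one_pos)) k := by
  refine ⟨_, uniform_mem_hypersimplex hn hkn, fun i j hij => ?_, ?_⟩
  · split_ifs with hj hi
    · rfl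
    · exact absurd ((Fin.le_def.1 hij).trans_lt hj) hi
    · exact le_mul_of_one_le_right (by positivity) (by nlinarith)
    · rfl
  · rw [charpoly_weightedSum, cholesky_transpose_mul_self, covMatrix_scaledBasis,
      diagonal_mul_diagonal, charpoly_diagonal]
    simp only [mul_ite, mul_one]

theorem scaledBasis_value_neg {d k n : ℝ} (hd : 1 ≤ d) (hdk : d + 1 ≤ k) (hkn : k + 1 ≤ n) :
    d / (k / n * (n ^ 2 + 1)) + (k - d) ^ 2 / ((n - d) * (k / n)) + (d - k) < 0 := by
  have hk : 0 < k := by linarith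
  have hn : 0 < n := by linarith
  have hnd : 0 < n - d := by linarith
  have hhead : d / (k / n * (n ^ 2 + 1)) < d / (k * n) := by
    have hexpand : k / n * (n ^ 2 + 1) = k * n + k / n := by field_simp
    rw [hexpand]
    gcongr
    linarith [div_pos hk hn]
  have hgap : (k - d) ^ 2 / ((n - d) * (k / n)) + (d - k) =
      -(d * ((k - d) * (n - k)) / (k * (n - d))) := by
    field_simp
    ring
  have hone : 1 ≤ (k - d) * (n - k) := by nlinarith
  have hdominate : d / (k * n) ≤ d * ((k - d) * (n - k)) / (k * (n - d)) := by
    gcongr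
    · nlinarith
    · linarith
  linarith

theorem nuM_scaledBasis_neg (hd : 1 ≤ d) (hdk : d < k) (hkn : k < n) :
    nuM (scaledBasis d n) one_pos k < 0 := by
  have hd' : (1 : ℝ) ≤ d := Nat.one_le_cast.2 hd
  have hdk' : (d : ℝ) + 1 ≤ k := by exact_mod_cast hdk
  have hkn' : (k : ℝ) + 1 ≤ n := by exact_mod_cast hkn
  have hn : (0 : ℝ) < n := by linarith
  have hkn0 : (0 : ℝ) < k / n := div_pos (by linarith) hn
  have hsplit : ((n : ℝ) - d) * (k / n) < (k - d) * (k / n * (n ^ 2 + 1)) := by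
    rw [mul_left_comm, mul_comm]
    gcongr
    nlinarith
  have hleast := isLeast_nuM (scaledBasis d n) one_pos (hd.trans hdk.le) hkn.le
  rw [relaxationValues_eq_image] at hleast
  refine (hleast.2 (Set.mem_image_of_mem _
    (scaledBasis_spectrum_mem_relaxationSpectra d (by omega) hkn.le))).trans_lt ?_
  rw [phi_ite hdk hkn.le hkn0.le hsplit, div_one]
  exact scaledBasis_value_neg hd' hdk' hkn'

end NegativeRelaxation

end RAOD

theorem mainTheorem8_general :
    (∀ (d n k : ℕ) (a : Fin n → Fin d → ℝ) (lam : ℝ) (hlam : 0 < lam), 1 ≤ k → k ≤ n →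
      IsLeast (RAOD.designValues a lam k) (RAOD.z a lam k) ∧
      IsLeast (RAOD.relaxationValues a hlam k) (RAOD.nuM a hlam k)) ∧
    (∀ (d n k : ℕ) (a : Fin n → Fin d → ℝ) (lam : ℝ) (hlam : 0 < lam), 1 ≤ k → k ≤ n → k ≤ d →
      1 ≤ RAOD.z a lam k / RAOD.nuM a hlam k ∧
      RAOD.z a lam k / RAOD.nuM a hlam k ≤ min ((d : ℝ) / (d - k + 1)) (n - k + 1)) ∧
    (∀ d k n : ℕ, 1 ≤ d → d + 1 ≤ k → k < n →
      ∃ (a : Fin n → Fin d → ℝ) (lam : ℝ) (hlam : 0 < lam), RAOD.nuM a hlam k < 0) := by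
  refine ⟨fun d n k a lam hlam hk hkn => ⟨?_, ?_⟩, fun d n k a lam hlam hk hkn hkd => ⟨?_, ?_⟩,
    fun d k n hd hdk hkn => ⟨RAOD.scaledBasis d n, 1, one_pos, ?_⟩⟩
  · exact RAOD.isLeast_z a lam hkn
  · exact RAOD.isLeast_nuM a hlam hk hkn
  · exact RAOD.one_le_z_div_nuM a hlam hk hkn hkd
  · exact le_min (RAOD.z_div_nuM_le_dim a hlam hk hkn hkd)
      (RAOD.z_div_nuM_le_size a hlam hk hkn hkd)
  · exact RAOD.nuM_scaledBasis_neg hd hdk hkn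

theorem mainTheorem8 :
    -- both optimal values are attained minima
    (∀ (d n k : ℕ) (a : Fin n → Fin d → ℝ) (lam : ℝ) (hlam : 0 < lam),
      1 ≤ d → d ≤ n → 1 ≤ k → k ≤ n →
        IsLeast (RAOD.designValues a lam k) (RAOD.z a lam k) ∧
        IsLeast (RAOD.relaxationValues a hlam k) (RAOD.nuM a hlam k)) ∧
    -- (i)
    (∀ (d n k : ℕ) (a : Fin n → Fin d → ℝ) (lam : ℝ) (hlam : 0 < lam),
      d ≤ n → 1 ≤ k → k ≤ d →
        1 ≤ RAOD.z a lam k / RAOD.nuM a hlam k ∧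
        (k < d → RAOD.z a lam k / RAOD.nuM a hlam k ≤
          min (((d : ℝ) - 1) / ((d : ℝ) - k)) ((n : ℝ) - k + 1)) ∧
        (k = d → RAOD.z a lam k / RAOD.nuM a hlam k ≤ min (d : ℝ) ((n : ℝ) - d + 1))) ∧
    -- (ii)
    (∀ d k n : ℕ, 1 ≤ d → d + 1 ≤ k → k < n →
      ∃ (a : Fin n → Fin d → ℝ) (lam : ℝ) (hlam : 0 < lam), RAOD.nuM a hlam k < 0) := by
  obtain ⟨hattained, hratio, hneg⟩ := mainTheorem8_general
  refine ⟨fun d n k a lam hlam _ _ => hattained d n k a lam hlam,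
    fun d n k a lam hlam hdn hk hkd => ?_, hneg⟩
  obtain ⟨hone, hle⟩ := hratio d n k a lam hlam hk (hkd.trans hdn) hkd
  refine ⟨hone, fun hlt => hle.trans (min_le_min_right _ ?_), ?_⟩
  · exact RAOD.div_sub_add_one_le_sub_one_div_sub (Nat.one_le_cast.2 hk) (Nat.cast_lt.2 hlt)
  · rintro rfl
    simpa using hle
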